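/- Let $(\xi_0,\xi_{12},W_1,W_2)$ be coordinates on $\mathbb C^4$, identified with $\mathbb H^2$ (as a right $\mathbb H$-module) by $(\xi_0,\xi_{12},W_1,W_2)\mapsto(\xi_0+j\xi_{12},\,W_1+jW_2)$, and let $\pi:\mathbb{CP}^3\to\mathbb{HP}^1=S^4$ be the twistor projection $[\xi_0,\xi_{12},W_1,W_2]\mapsto[\xi_0+j\xi_{12},W_1+jW_2]$. The identity component $SO_\circ(1,5)$ of $O(1,5)$ acts on $S^4$ by orientation-preserving conformal transformations, and on $\mathbb{CP}^3$ by letting $\varphi\in SO_\circ(1,5)$ act through the unique projective transformation of $\mathbb{CP}^3$ that covers $\varphi$ under $\pi$. Two subsets of $\mathbb{CP}^3$ are called equivalent if an element of $SO_\circ(1,5)$ maps one onto the other. For $\lambda,\mu,\nu\in\mathbb R$ let $\mathscr Q_{\lambda,\mu,\nu}\subset\mathbb{CP}^3$ be the zero set of $$e^{\lambda+i\nu}\xi_0^2+e^{-\lambda+i\nu}\xi_{12}^2+e^{\mu-i\nu}W_1^2+e^{-\mu-i\nu}W_2^2,$$ and for $k\in[0,1)$ let $\mathscr N_k$ be the zero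 set of $$i(\xi_0^2+\xi_{12}^2)-k\,\xi_0W_1+k\,\xi_{12}W_2-\xi_0W_2+\xi_{12}W_1.$$ (1) Every non-singular quadric in $\mathbb{CP}^3$ is equivalent to some $\mathscr Q_{\lambda,\mu,\nu}$ with $0\le\lambda\le\mu$ and $\nu\in[0,\pi/2)$, or to some $\mathscr N_k$ with $k\in[0,1)$. (2) For all $(\lambda,\mu,\nu),(\lambda',\mu',\nu')\in\mathbb R^3$, $\mathscr Q_{\lambda,\mu,\nu}$ and $\mathscr Q_{\lambda',\mu',\nu'}$ are equivalent if and only if $(\lambda,\mu,\nu)$ and $(\lambda',\mu',\nu')$ lie in the same orbit of the group $\Gamma$ of transformations of $\mathbb R^3$ generated by $$(\lambda,\mu,\nu)\mapsto(\lambda,\mu,\nu+\tfrac\pi2),\quad(\lambda,\mu,\nu)\mapsto(-\lambda,\mu,\nu),\quad(\lambda,\mu,\nu)\mapsto(\lambda,-\mu,\nu),\quad(\lambda,\mu,\nu)\mapsto(\mu,\lambda,-\nu).$$ (3) For $k,k'\in[0,1)$, $\mathscr N_k$ and $\mathscr N_{k'}$ are equivalent if and only if $k=k'$. (4) For $k\in[0,1)$,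 $\mathscr N_k$ is not equivalent to any non-singular quadric $a\xi_0^2+b\xi_{12}^2+cW_1^2+dW_2^2=0$; in particular it is not equivalent to any $\mathscr Q_{\lambda,\mu,\nu}$. (5) The quadrics defined by two invertible complex symmetric $4\times4$ matrices $Q,Q'$ are equivalent if and only if $Q'=\gamma\,G^{\top}QG$ for some $\gamma\in\mathbb C^*$ and some $G\in SL(2,\mathbb H)$, where $SL(2,\mathbb H)$ is the group of $\mathbb H$-linear maps of $\mathbb H^2=\mathbb C^4$ of complex determinant $1$; so (1)–(4) hold equally for this equivalence of symmetric matrices. -/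

import Mathlib

open scoped Matrix

noncomputable section

namespace TwistorQuadrics

/-! Vectors of `ℂ⁴` are written `v = (ξ₀, ξ₁₂, W₁, W₂)`, i.e. `v 0 = ξ₀`, `v 1 = ξ₁₂`,
`v 2 = W₁`, `v 3 = W₂`. -/

/-- Complex projective 3-space. -/
abbrev CP3 : Type := Projectivization ℂ (Fin 4 → ℂ)

/-! ### Quadrics -/

/-- The zero set in `ℂℙ³` of the quadratic form `v ↦ vᵀ Q v`. -/
def quadric (Q : Matrix (Fin 4) (Fin 4) ℂ) : Set CP3 :=
  {p | ∀ v ∈ p.submodule, v ⬝ᵥ (Q *ᵥ v) = 0}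

/-- A non-singular quadric hypersurface: the zero set of a quadratic form of rank 4. -/
def IsNonsingularQuadric (S : Set CP3) : Prop :=
  ∃ Q : Matrix (Fin 4) (Fin 4) ℂ, Q.IsSymm ∧ Q.det ≠ 0 ∧ S = quadric Q

/-! ### The twistor projection and the conformal group -/

/-- The quaternion unit `j`. -/
def quatJ : Quaternion ℝ := ⟨0, 0, 1, 0⟩

/-- The quaternion `z₁ + j z₂` determined by two complex numbers. -/
def toQuat (z₁ z₂ : ℂ) : Quaternion ℝ :=
  Quaternion.coeComplex z₁ + quatJ * Quaternion.coeComplex z₂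

theorem toQuat_components (z₁ z₂ : ℂ) :
    (toQuat z₁ z₂).re = z₁.re ∧ (toQuat z₁ z₂).imI = z₁.im ∧
      (toQuat z₁ z₂).imJ = z₂.re ∧ (toQuat z₁ z₂).imK = -z₂.im := by
  have h0 : quatJ.re = 0 := rfl
  have h1 : quatJ.imI = 0 := rfl
  have h2 : quatJ.imJ = 1 := rfl
  have h3 : quatJ.imK = 0 := rfl
  refine ⟨?_, ?_, ?_, ?_⟩ <;> simp [toQuat, h0, h1, h2, h3]

/-- The Lorentzian inner product of signature `(1,5)` on `ℝ⁶`. -/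
def lorentz : Matrix (Fin 6) (Fin 6) ℝ :=
  Matrix.diagonal ![1, -1, -1, -1, -1, -1]

/-- The group `O(1,5)`. -/
def O15 : Set (Matrix (Fin 6) (Fin 6) ℝ) := {A | Aᵀ * lorentz * A = lorentz}

/-- The group `SO_∘(1,5)`, the identity component of `O(1,5)`. -/
def SO15 : Set (Matrix (Fin 6) (Fin 6) ℝ) := connectedComponentIn O15 1

/-- The twistor projection `ℂℙ³ → ℍℙ¹ = S⁴`, `[v] ↦ [q₁, q₂]` with `q₁ = ξ₀ + j ξ₁₂` and
`q₂ = W₁ + j W₂`, where `S⁴` is the set of rays of the future light cone of `ℝ^{1,5}` (on which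
`SO_∘(1,5)` acts as the group of orientation preserving conformal transformations).
In the affine coordinate `q = q₂ q₁⁻¹ ∈ ℍ = ℝ⁴`, the vector below is
`|q₁|² (1 + |q|², 1 - |q|², 2 q)`, so that its ray is the inverse stereographic image of `q`. -/
def twistorVec (v : Fin 4 → ℂ) : Fin 6 → ℝ :=
  let q₁ := toQuat (v 0) (v 1)
  let q₂ := toQuat (v 2) (v 3)
  let q := q₂ * star q₁
  ![Quaternion.normSq q₁ + Quaternion.normSq q₂, Quaternion.normSq q₁ - Quaternion.normSq q₂,
    2 * q.re, 2 * q.imI, 2 * q.imJ, 2 * q.imK]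

/-- The projective transformation of `ℂℙ³` defined by `F` covers, through the twistor
projection, the conformal transformation of `S⁴` defined by `φ`. A given `φ` is covered by exactly
one projective transformation: this is the action of `SO_∘(1,5)` on `ℂℙ³`. -/
def Covers (F : (Fin 4 → ℂ) ≃ₗ[ℂ] (Fin 4 → ℂ)) (φ : Matrix (Fin 6) (Fin 6) ℝ) : Prop :=
  ∀ v : Fin 4 → ℂ, ∃ r : ℝ, 0 < r ∧ twistorVec (F v) = r • (φ *ᵥ twistorVec v)

/-- Two subsets of `ℂℙ³` are related by the action of an element of `SO_∘(1,5)`. -/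
def ConfEquiv (S T : Set CP3) : Prop :=
  ∃ φ ∈ SO15, ∃ F : (Fin 4 → ℂ) ≃ₗ[ℂ] (Fin 4 → ℂ), Covers F φ ∧
    Projectivization.map F.toLinearMap F.injective '' S = T

/-! ### Equivalence of quadratic forms -/

/-- Right multiplication by the quaternion `j` on `ℍ² = ℂ⁴` is `v ↦ 𝕁 v̄`. -/
def Jr : Matrix (Fin 4) (Fin 4) ℂ :=
  !![0, -1, 0, 0;
     1, 0, 0, 0;
     0, 0, 0, -1;
     0, 0, 1, 0]

/-- The group `SL(2,ℍ)`, as a group of complex `4 × 4` matrices. -/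
def SL2H : Set (Matrix (Fin 4) (Fin 4) ℂ) :=
  {G | G * Jr = Jr * G.map (starRingEnd ℂ) ∧ G.det = 1}

/-- Equivalence of quadratic forms (complex symmetric matrices). -/
def FormEquiv (Q Q' : Matrix (Fin 4) (Fin 4) ℂ) : Prop :=
  ∃ G ∈ SL2H, ∃ γ : ℂ, γ ≠ 0 ∧ Q' = γ • (Gᵀ * Q * G)

/-! ### The canonical forms -/

/-- `e^{λ+iν} ξ₀² + e^{-λ+iν} ξ₁₂² + e^{μ-iν} W₁² + e^{-μ-iν} W₂²`, where the parameter is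
`(λ, μ, ν)`. -/
def diagForm (p : ℝ × ℝ × ℝ) : Matrix (Fin 4) (Fin 4) ℂ :=
  Matrix.diagonal
    ![Complex.exp (p.1 + Complex.I * p.2.2), Complex.exp (-p.1 + Complex.I * p.2.2),
      Complex.exp (p.2.1 - Complex.I * p.2.2), Complex.exp (-p.2.1 - Complex.I * p.2.2)]

/-- `i (ξ₀² + ξ₁₂²) - k ξ₀ W₁ + k ξ₁₂ W₂ - ξ₀ W₂ + ξ₁₂ W₁`. -/
def nonDiagForm (k : ℝ) : Matrix (Fin 4) (Fin 4) ℂ :=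
  !![Complex.I, 0, -(k / 2), -(1 / 2);
     0, Complex.I, 1 / 2, k / 2;
     -(k / 2), 1 / 2, 0, 0;
     -(1 / 2), k / 2, 0, 0]

/-- The matrix `nonDiagForm k` represents the form that its description says. -/
theorem nonDiagForm_apply (k : ℝ) (v : Fin 4 → ℂ) :
    v ⬝ᵥ (nonDiagForm k *ᵥ v) =
      Complex.I * (v 0 ^ 2 + v 1 ^ 2) - k * v 0 * v 2 + k * v 1 * v 3 - v 0 * v 3 + v 1 * v 2 := by
  simp [nonDiagForm, dotProduct, Matrix.mulVec, Fin.sum_univ_four]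
  ring

/-! ### The group `Γ` of transformations of the parameter space -/

/-- `(λ, μ, ν) ↦ (λ, μ, ν + π/2)` -/
def shiftNu : Equiv.Perm (ℝ × ℝ × ℝ) where
  toFun p := (p.1, p.2.1, p.2.2 + Real.pi / 2)
  invFun p := (p.1, p.2.1, p.2.2 - Real.pi / 2)
  left_inv p := by simp
  right_inv p := by simp

/-- `(λ, μ, ν) ↦ (-λ, μ, ν)` -/
def negLam : Equiv.Perm (ℝ × ℝ × ℝ) where
  toFun p := (-p.1, p.2.1, p.2.2)
  invFun p := (-p.1, p.2.1, p.2.2)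
  left_inv p := by simp
  right_inv p := by simp

/-- `(λ, μ, ν) ↦ (λ, -μ, ν)` -/
def negMu : Equiv.Perm (ℝ × ℝ × ℝ) where
  toFun p := (p.1, -p.2.1, p.2.2)
  invFun p := (p.1, -p.2.1, p.2.2)
  left_inv p := by simp
  right_inv p := by simp

/-- `(λ, μ, ν) ↦ (μ, λ, -ν)` -/
def swapLamMu : Equiv.Perm (ℝ × ℝ × ℝ) where
  toFun p := (p.2.1, p.1, -p.2.2)
  invFun p := (p.2.1, p.1, -p.2.2)
  left_inv p := by simp
  right_inv p := by simp

/-- The group `Γ` of transformations of `ℝ³` generated by the four maps above. -/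
def Gam : Subgroup (Equiv.Perm (ℝ × ℝ × ℝ)) :=
  Subgroup.closure {shiftNu, negLam, negMu, swapLamMu}

end TwistorQuadrics

end

/-!
Write `v ↦ vj` (`rightJ`) for right multiplication by `j` on `ℍ² = ℂ⁴`. A complex matrix lies in
`SL(2,ℍ)` if it commutes with it and has determinant `1`.

*From quadrics to forms.* A quadric determines its form up to scale, since the restriction of a
quadratic form to a line is determined up to scale by its zeros (`exists_smul_of_quadric_eq`). The
identity `det [u, uj, w, wj] = ⟨π u, π w⟩ / 2` (`det_frame`), with the Lorentzian product of points
of the light cone on the right, shows that determinants of quaternionic matrices are nonnegative,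
that `SL(2,ℍ)` acts on `ℝ^{1,5}` by isometries, and that the fibres of `π` are the quaternionic
lines. If `F` covers a conformal map, then `j F j F⁻¹` preserves all these lines, which forces it to
be a scalar, so a multiple of `F` is quaternionic (`Covers.exists_isQuaternionic`). Conversely the
invertible quaternionic matrices are connected, through segments that change one column at a time,
so they act through the identity component (`conf_frame_mem_SO15`). Hence two quadrics are
equivalent exactly when their forms are (`confEquiv_quadric_iff`).

*Classification of forms.* To a symmetric form `Q` there belongs the conjugate form
`Q* (u, v) = conj Q(uj, vj)`, and `SL(2,ℍ)` acts on the pencil spanned by `Q` and `Q*`. The map `j`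
interchanges the eigenvalues `t` and `1 / conj t` of `Q*` relative to `Q`. If some eigenvector is
not isotropic, then its quaternionic line contains an eigenvector `v` orthogonal to `vj`, the
orthogonal complement of the line is a quaternionic line too, and `Q` is diagonalizable
(`IsEig.formEquiv_diagonal`); scaling the basis and the form gives a `diagForm`. Otherwise every
eigenvector starts a Jordan chain `u₁, u₂`, and `u₁, u₁j, u₂, u₂j` is a basis whose Gram matrix can
be brought to a normal form that depends only on the modulus `r ≥ 1` of the eigenvalue
(`IsChain.formEquiv_chainForm`). The form `nonDiagForm k` has the same normal form, with
`r = (1 + k) / (1 - k)`.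

*Invariants.* An equivalence multiplies all eigenvalues by one phase, which is `±1` between forms of
determinant `1`, and preserves Jordan chains. So `k` is an invariant, forms with a chain are not
diagonalizable, and the eigenvalues `exp (±2λ - 2iν)`, `exp (±2μ + 2iν)` of a `diagForm` determine
its parameters up to the group `Γ` (`sameOrbit_of_formEquiv`).
-/

namespace TwistorQuadrics

open scoped ComplexConjugate

noncomputable section

/-! ### Right multiplication by `j` and quaternionic matrices -/

/-- Right multiplication by the quaternion `j` on `ℍ² = ℂ⁴`, a conjugate linear map. -/
def rightJ (v : Fin 4 → ℂ) : Fin 4 → ℂ :=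
  ![-conj (v 1), conj (v 0), -conj (v 3), conj (v 2)]

@[simp] theorem rightJ_apply_zero (v : Fin 4 → ℂ) : rightJ v 0 = -conj (v 1) := rfl
@[simp] theorem rightJ_apply_one (v : Fin 4 → ℂ) : rightJ v 1 = conj (v 0) := rfl
@[simp] theorem rightJ_apply_two (v : Fin 4 → ℂ) : rightJ v 2 = -conj (v 3) := rfl
@[simp] theorem rightJ_apply_three (v : Fin 4 → ℂ) : rightJ v 3 = conj (v 2) := rfl

@[simp] theorem rightJ_rightJ (v : Fin 4 → ℂ) : rightJ (rightJ v) = -v := by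
  ext i; fin_cases i <;> simp

@[simp] theorem rightJ_add (u v : Fin 4 → ℂ) : rightJ (u + v) = rightJ u + rightJ v := by
  ext i; fin_cases i <;> simp <;> ring

@[simp] theorem rightJ_smul (c : ℂ) (v : Fin 4 → ℂ) : rightJ (c • v) = conj c • rightJ v := by
  ext i; fin_cases i <;> simp

@[simp] theorem rightJ_neg (v : Fin 4 → ℂ) : rightJ (-v) = -rightJ v := by
  ext i; fin_cases i <;> simp

@[simp] theorem rightJ_zero : rightJ 0 = 0 := by
  ext i; fin_cases i <;> simp

@[simp] theorem rightJ_eq_zero {v : Fin 4 → ℂ} : rightJ v = 0 ↔ v = 0 := by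
  refine ⟨fun h => ?_, fun h => by simp [h]⟩
  have := congrArg rightJ h
  simpa using this

theorem Jr_mulVec_conj (v : Fin 4 → ℂ) : Jr *ᵥ (fun i => conj (v i)) = rightJ v := by
  ext i; fin_cases i <;> simp [Jr, Matrix.mulVec, dotProduct, Fin.sum_univ_four]

/-- A complex matrix is quaternionic if it commutes with right multiplication by `j`. -/
def IsQuaternionic (G : Matrix (Fin 4) (Fin 4) ℂ) : Prop :=
  G * Jr = Jr * G.map (starRingEnd ℂ)

theorem conj_mulVec (G : Matrix (Fin 4) (Fin 4) ℂ) (v : Fin 4 → ℂ) :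
    (fun i => conj ((G *ᵥ v) i)) = G.map (starRingEnd ℂ) *ᵥ (fun i => conj (v i)) := by
  ext i; simp [Matrix.mulVec, dotProduct]

theorem isQuaternionic_iff {G : Matrix (Fin 4) (Fin 4) ℂ} :
    IsQuaternionic G ↔ ∀ v, G *ᵥ rightJ v = rightJ (G *ᵥ v) := by
  have key : ∀ v, (G * Jr) *ᵥ (fun i => conj (v i)) = G *ᵥ rightJ v ∧
      (Jr * G.map (starRingEnd ℂ)) *ᵥ (fun i => conj (v i)) = rightJ (G *ᵥ v) := fun v => by
    rw [← Matrix.mulVec_mulVec, ← Matrix.mulVec_mulVec, Jr_mulVec_conj, ← conj_mulVec,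
      Jr_mulVec_conj]
    exact ⟨rfl, rfl⟩
  constructor
  · intro h v
    rw [← (key v).1, ← (key v).2, h]
  · intro h
    refine Matrix.mulVec_injective (funext fun v => ?_)
    have := key (fun i => conj (v i))
    simp only [Complex.conj_conj] at this
    rw [this.1, this.2, h]

theorem IsQuaternionic.mulVec_rightJ {G : Matrix (Fin 4) (Fin 4) ℂ} (h : IsQuaternionic G)
    (v : Fin 4 → ℂ) : G *ᵥ rightJ v = rightJ (G *ᵥ v) := isQuaternionic_iff.1 h v

theorem IsQuaternionic.one : IsQuaternionic 1 := isQuaternionic_iff.2 fun v => by simp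

theorem IsQuaternionic.mul {G H : Matrix (Fin 4) (Fin 4) ℂ} (hG : IsQuaternionic G)
    (hH : IsQuaternionic H) : IsQuaternionic (G * H) := isQuaternionic_iff.2 fun v => by
  rw [← Matrix.mulVec_mulVec, ← Matrix.mulVec_mulVec, hH.mulVec_rightJ, hG.mulVec_rightJ]

theorem IsQuaternionic.smul {G : Matrix (Fin 4) (Fin 4) ℂ} (hG : IsQuaternionic G) (t : ℝ) :
    IsQuaternionic ((t : ℂ) • G) := isQuaternionic_iff.2 fun v => by
  rw [Matrix.smul_mulVec, Matrix.smul_mulVec, hG.mulVec_rightJ, rightJ_smul, Complex.conj_ofReal]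

theorem IsQuaternionic.inv {G : Matrix (Fin 4) (Fin 4) ℂ} (hG : IsQuaternionic G)
    (h0 : G.det ≠ 0) : IsQuaternionic G⁻¹ := isQuaternionic_iff.2 fun v => by
  have hu : IsUnit G.det := isUnit_iff_ne_zero.2 h0
  have hl : ∀ x, G⁻¹ *ᵥ (G *ᵥ x) = x := fun x => by
    rw [Matrix.mulVec_mulVec, Matrix.nonsing_inv_mul _ hu, Matrix.one_mulVec]
  have hr : ∀ x, G *ᵥ (G⁻¹ *ᵥ x) = x := fun x => by
    rw [Matrix.mulVec_mulVec, Matrix.mul_nonsing_inv _ hu, Matrix.one_mulVec]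
  rw [← hl (rightJ (G⁻¹ *ᵥ v)), hG.mulVec_rightJ, hr]

/-- The matrix with columns `u`, `uj`, `w`, `wj`: the `ℍ`-linear endomorphism of `ℍ²` that sends the
standard basis to `u`, `w`. -/
def frame (u w : Fin 4 → ℂ) : Matrix (Fin 4) (Fin 4) ℂ :=
  Matrix.of fun i k => ![u i, rightJ u i, w i, rightJ w i] k

theorem frame_mulVec (u w x : Fin 4 → ℂ) :
    frame u w *ᵥ x = x 0 • u + x 1 • rightJ u + x 2 • w + x 3 • rightJ w := by
  ext i
  simp [frame, Matrix.mulVec, dotProduct, Fin.sum_univ_four]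
  ring

theorem isQuaternionic_frame (u w : Fin 4 → ℂ) : IsQuaternionic (frame u w) :=
  isQuaternionic_iff.2 fun v => by
    rw [frame_mulVec, frame_mulVec]
    simp only [rightJ_apply_zero, rightJ_apply_one, rightJ_apply_two, rightJ_apply_three,
      rightJ_add, rightJ_smul, rightJ_rightJ]
    module

/-- Every quaternionic matrix is the frame of its columns `0` and `2`. -/
theorem IsQuaternionic.eq_frame {G : Matrix (Fin 4) (Fin 4) ℂ} (hG : IsQuaternionic G) :
    G = frame (G *ᵥ Pi.single 0 1) (G *ᵥ Pi.single 2 1) := by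
  have h0 := hG.mulVec_rightJ (Pi.single 0 1)
  have h2 := hG.mulVec_rightJ (Pi.single 2 1)
  have e0 : rightJ (Pi.single 0 1) = Pi.single 1 1 := by ext i; fin_cases i <;> simp
  have e2 : rightJ (Pi.single 2 1) = Pi.single 3 1 := by ext i; fin_cases i <;> simp
  rw [e0] at h0
  rw [e2] at h2
  refine Matrix.mulVec_injective (funext fun v => ?_)
  rw [frame_mulVec, ← h0, ← h2]
  simp only [← Matrix.mulVec_smul, ← Matrix.mulVec_add]
  congr 1
  ext i
  fin_cases i <;> simp

/-- The Lorentzian inner product of `ℝ^{1,5}`. -/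
def lor (x y : Fin 6 → ℝ) : ℝ := x ⬝ᵥ (lorentz *ᵥ y)

theorem lor_apply (x y : Fin 6 → ℝ) : lor x y =
    x 0 * y 0 - x 1 * y 1 - x 2 * y 2 - x 3 * y 3 - x 4 * y 4 - x 5 * y 5 := by
  simp [lor, lorentz, dotProduct, Matrix.mulVec_diagonal, Fin.sum_univ_six]
  ring

/-- The twistor projection in complex coordinates, free of quaternions. -/
theorem twistorVec_apply (v : Fin 4 → ℂ) : twistorVec v =
    ![Complex.normSq (v 0) + Complex.normSq (v 1) + (Complex.normSq (v 2) + Complex.normSq (v 3)),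
      Complex.normSq (v 0) + Complex.normSq (v 1) - (Complex.normSq (v 2) + Complex.normSq (v 3)),
      2 * (v 2 * conj (v 0) + conj (v 3) * v 1).re, 2 * (v 2 * conj (v 0) + conj (v 3) * v 1).im,
      2 * (v 3 * conj (v 0) - conj (v 2) * v 1).re,
      -2 * (v 3 * conj (v 0) - conj (v 2) * v 1).im] := by
  obtain ⟨h1, h2, h3, h4⟩ := toQuat_components (v 0) (v 1)
  obtain ⟨k1, k2, k3, k4⟩ := toQuat_components (v 2) (v 3)
  ext i
  fin_cases i <;> simp [twistorVec, Quaternion.normSq_def', h1, h2, h3, h4, k1, k2, k3, k4,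
    Complex.normSq_apply] <;> ring

/-- The link between determinants and Lorentzian geometry: nonzero `u`, `w` are independent over
`ℍ` exactly when their images under the twistor projection are distinct rays of the light cone. -/
theorem det_frame (u w : Fin 4 → ℂ) :
    (frame u w).det = ((lor (twistorVec u) (twistorVec w) / 2 : ℝ) : ℂ) := by
  have hre : ∀ z : ℂ, (z.re : ℂ) = (z + conj z) / 2 := fun z => Complex.re_eq_add_conj z
  have him : ∀ z : ℂ, (z.im : ℂ) = -(Complex.I / 2) * (z - conj z) := fun z => by
    rw [Complex.im_eq_sub_conj]; field_simp; rw [Complex.I_sq]; ring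
  rw [lor_apply, twistorVec_apply, twistorVec_apply]
  simp only [Matrix.cons_val, Complex.ofReal_div, Complex.ofReal_sub, Complex.ofReal_mul,
    Complex.ofReal_add, Complex.ofReal_neg, Complex.ofReal_ofNat, ← Complex.mul_conj, hre, him]
  simp only [map_mul, map_add, map_sub, Complex.conj_conj]
  simp [frame, Matrix.det_succ_row_zero, Fin.sum_univ_succ, Fin.succAbove]
  ring_nf
  simp only [Complex.I_sq]
  ring

/-! ### Determinants of quaternionic matrices -/

theorem lor_twistorVec_self (v : Fin 4 → ℂ) : lor (twistorVec v) (twistorVec v) = 0 := by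
  have h := det_frame v v
  rw [Matrix.det_zero_of_column_eq (i := 0) (j := 2) (by decide) (by intro k; simp [frame])] at h
  have : lor (twistorVec v) (twistorVec v) / 2 = 0 := by exact_mod_cast h.symm
  linarith

theorem twistorVec_zero_nonneg (v : Fin 4 → ℂ) : 0 ≤ twistorVec v 0 := by
  rw [twistorVec_apply]
  simp only [Matrix.cons_val]
  have := Complex.normSq_nonneg
  linarith [this (v 0), this (v 1), this (v 2), this (v 3)]

/-- Two vectors of the future light cone have nonnegative product, by Cauchy-Schwarz. -/
theorem lor_twistorVec_nonneg (u w : Fin 4 → ℂ) : 0 ≤ lor (twistorVec u) (twistorVec w) := by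
  have hu := lor_twistorVec_self u
  have hw := lor_twistorVec_self w
  have hu0 := twistorVec_zero_nonneg u
  have hw0 := twistorVec_zero_nonneg w
  generalize twistorVec u = x at *
  generalize twistorVec w = y at *
  rw [lor_apply] at *
  have cs := Finset.sum_mul_sq_le_sq_mul_sq Finset.univ
    ![x 1, x 2, x 3, x 4, x 5] ![y 1, y 2, y 3, y 4, y 5]
  simp only [Fin.sum_univ_five, Matrix.cons_val] at cs
  have hx : x 1 ^ 2 + x 2 ^ 2 + x 3 ^ 2 + x 4 ^ 2 + x 5 ^ 2 = x 0 ^ 2 := by linarith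
  have hy : y 1 ^ 2 + y 2 ^ 2 + y 3 ^ 2 + y 4 ^ 2 + y 5 ^ 2 = y 0 ^ 2 := by linarith
  rw [hx, hy, ← mul_pow] at cs
  have := abs_le_of_sq_le_sq' cs (mul_nonneg hu0 hw0)
  linarith [this.2]

/-- The determinant of a quaternionic matrix is a nonnegative real number. -/
theorem IsQuaternionic.exists_det {G : Matrix (Fin 4) (Fin 4) ℂ} (hG : IsQuaternionic G) :
    ∃ d : ℝ, 0 ≤ d ∧ G.det = d := by
  rw [hG.eq_frame]
  exact ⟨_, div_nonneg (lor_twistorVec_nonneg _ _) two_pos.le, det_frame _ _⟩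

/-- A vector `u` is recovered from `uq`, `q = a + jb`, by right multiplication with the conjugate of
the quaternion `q`. -/
theorem normSq_add_smul (a b : ℂ) (u : Fin 4 → ℂ) :
    ((Complex.normSq a + Complex.normSq b : ℝ) : ℂ) • u =
      conj a • (a • u + b • rightJ u) - b • rightJ (a • u + b • rightJ u) := by
  simp only [rightJ_add, rightJ_smul, rightJ_rightJ, Complex.ofReal_add, ← Complex.mul_conj]
  module

theorem normSq_add_ne_zero {a b : ℂ} (h : a ≠ 0 ∨ b ≠ 0) :
    ((Complex.normSq a + Complex.normSq b : ℝ) : ℂ) ≠ 0 := by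
  have ha := Complex.normSq_nonneg a
  have hb := Complex.normSq_nonneg b
  rcases h with h | h <;> have := Complex.normSq_pos.2 h <;>
    exact_mod_cast (by positivity : Complex.normSq a + Complex.normSq b ≠ 0)

theorem smul_add_smul_rightJ_ne_zero {a b : ℂ} (h : a ≠ 0 ∨ b ≠ 0) {u : Fin 4 → ℂ} (hu : u ≠ 0) :
    a • u + b • rightJ u ≠ 0 := fun h0 => by
  have := normSq_add_smul a b u
  rw [h0] at this
  simp only [smul_zero, rightJ_zero, sub_zero] at this
  exact (smul_ne_zero (normSq_add_ne_zero h) hu) this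

theorem exists_eq_of_det_frame_eq_zero {u w : Fin 4 → ℂ} (hu : u ≠ 0) (h : (frame u w).det = 0) :
    ∃ a b : ℂ, w = a • u + b • rightJ u := by
  obtain ⟨x, hx, hx0⟩ := Matrix.exists_mulVec_eq_zero_iff.2 h
  rw [frame_mulVec] at hx0
  by_cases h23 : x 2 ≠ 0 ∨ x 3 ≠ 0
  · have hN := normSq_add_ne_zero h23
    have h1 := normSq_add_smul (x 2) (x 3) w
    have h2 : x 2 • w + x 3 • rightJ w = -(x 0 • u + x 1 • rightJ u) := by
      rw [eq_neg_iff_add_eq_zero, ← hx0]; module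
    rw [h2] at h1
    set N := ((Complex.normSq (x 2) + Complex.normSq (x 3) : ℝ) : ℂ)
    simp only [rightJ_neg, rightJ_add, rightJ_smul, rightJ_rightJ] at h1
    refine ⟨N⁻¹ * (-conj (x 2) * x 0 - x 3 * conj (x 1)),
      N⁻¹ * (-conj (x 2) * x 1 + x 3 * conj (x 0)), ?_⟩
    rw [← inv_smul_smul₀ hN w, h1]
    module
  · push Not at h23
    rw [h23.1, h23.2, zero_smul, zero_smul, add_zero, add_zero] at hx0
    by_cases h01 : x 0 ≠ 0 ∨ x 1 ≠ 0
    · exact absurd hx0 (smul_add_smul_rightJ_ne_zero h01 hu)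
    · push Not at h01
      refine absurd (funext fun i => ?_) hx
      fin_cases i <;> simp [h23.1, h23.2, h01.1, h01.2]

/-! ### Bilinear forms -/

/-- The bilinear form of the matrix `Q`. -/
def bil (Q : Matrix (Fin 4) (Fin 4) ℂ) (u v : Fin 4 → ℂ) : ℂ := u ⬝ᵥ (Q *ᵥ v)

section bil
variable (Q : Matrix (Fin 4) (Fin 4) ℂ) (u v w : Fin 4 → ℂ) (c : ℂ)

@[simp] theorem bil_add_left : bil Q (u + v) w = bil Q u w + bil Q v w := by
  simp [bil, add_dotProduct]
@[simp] theorem bil_add_right : bil Q u (v + w) = bil Q u v + bil Q u w := by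
  simp [bil, Matrix.mulVec_add, dotProduct_add]
@[simp] theorem bil_smul_left : bil Q (c • u) v = c * bil Q u v := by
  simp [bil, smul_dotProduct]
@[simp] theorem bil_smul_right : bil Q u (c • v) = c * bil Q u v := by
  simp [bil, Matrix.mulVec_smul, dotProduct_smul]
@[simp] theorem bil_neg_left : bil Q (-u) v = -bil Q u v := by
  simp [bil]
@[simp] theorem bil_neg_right : bil Q u (-v) = -bil Q u v := by
  simp [bil, Matrix.mulVec_neg]
@[simp] theorem bil_zero_right : bil Q u 0 = 0 := by simp [bil]

@[simp] theorem bil_smul_matrix : bil (c • Q) u v = c * bil Q u v := by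
  simp [bil, Matrix.smul_mulVec]

theorem bil_congr_matrix (G : Matrix (Fin 4) (Fin 4) ℂ) :
    bil (Gᵀ * Q * G) u v = bil Q (G *ᵥ u) (G *ᵥ v) := by
  simp only [bil]
  rw [Matrix.mul_assoc, ← Matrix.mulVec_mulVec, Matrix.dotProduct_mulVec, Matrix.vecMul_transpose,
    ← Matrix.mulVec_mulVec]

theorem bil_single (i k : Fin 4) : bil Q (Pi.single i 1) (Pi.single k 1) = Q i k := by
  simp [bil]

theorem bil_comm {Q : Matrix (Fin 4) (Fin 4) ℂ} (hQ : Q.IsSymm) : bil Q u v = bil Q v u := by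
  rw [bil, bil, Matrix.dotProduct_mulVec, ← Matrix.mulVec_transpose, hQ.eq, dotProduct_comm]

end bil

theorem ext_bil {Q Q' : Matrix (Fin 4) (Fin 4) ℂ} (h : ∀ u v, bil Q u v = bil Q' u v) : Q = Q' := by
  ext i k
  rw [← bil_single Q, ← bil_single Q', h]

theorem eq_zero_of_bil {Q : Matrix (Fin 4) (Fin 4) ℂ} (hQ : Q.IsSymm) (h0 : Q.det ≠ 0)
    {u : Fin 4 → ℂ} (h : ∀ v, bil Q u v = 0) : u = 0 := by
  by_contra hu
  refine h0 (Matrix.exists_mulVec_eq_zero_iff.1 ⟨u, hu, ?_⟩)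
  ext i
  have := h (Pi.single i 1)
  rw [bil_comm _ _ hQ] at this
  simpa [bil] using this

theorem exists_eq_of_det_frame_ne_zero {u w : Fin 4 → ℂ} (hd : (frame u w).det ≠ 0)
    (v : Fin 4 → ℂ) :
    ∃ a b c d : ℂ, v = a • u + b • rightJ u + c • w + d • rightJ w := by
  refine ⟨((frame u w)⁻¹ *ᵥ v) 0, ((frame u w)⁻¹ *ᵥ v) 1, ((frame u w)⁻¹ *ᵥ v) 2,
    ((frame u w)⁻¹ *ᵥ v) 3, ?_⟩
  rw [← frame_mulVec, Matrix.mulVec_mulVec, Matrix.mul_nonsing_inv _ (isUnit_iff_ne_zero.2 hd),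
    Matrix.one_mulVec]

theorem FormEquiv.trans {Q Q' Q'' : Matrix (Fin 4) (Fin 4) ℂ} (h : FormEquiv Q Q')
    (h' : FormEquiv Q' Q'') : FormEquiv Q Q'' := by
  obtain ⟨G, ⟨hG, hG1⟩, γ, hγ, rfl⟩ := h
  obtain ⟨H, ⟨hH, hH1⟩, δ, hδ, rfl⟩ := h'
  refine ⟨G * H, ⟨IsQuaternionic.mul hG hH, by rw [Matrix.det_mul, hG1, hH1, mul_one]⟩, δ * γ,
    mul_ne_zero hδ hγ, ?_⟩
  simp only [Matrix.transpose_mul, Matrix.mul_smul, Matrix.smul_mul, smul_smul, Matrix.mul_assoc]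

theorem FormEquiv.symm {Q Q' : Matrix (Fin 4) (Fin 4) ℂ} (h : FormEquiv Q Q') :
    FormEquiv Q' Q := by
  obtain ⟨G, ⟨hG, hG1⟩, γ, hγ, rfl⟩ := h
  have hu : IsUnit G.det := by simp [hG1]
  refine ⟨G⁻¹, ⟨IsQuaternionic.inv hG (by simp [hG1]), by simp [Matrix.det_nonsing_inv, hG1]⟩,
    γ⁻¹, inv_ne_zero hγ, ?_⟩
  refine ext_bil fun u v => ?_
  have hr : ∀ x, G *ᵥ (G⁻¹ *ᵥ x) = x := fun x => by
    rw [Matrix.mulVec_mulVec, Matrix.mul_nonsing_inv _ hu, Matrix.one_mulVec]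
  rw [bil_smul_matrix, bil_congr_matrix, bil_smul_matrix, bil_congr_matrix, hr, hr,
    inv_mul_cancel_left₀ hγ]

/-- The determinant of `G` need not be `1`: it is positive, so a real multiple of `G` lies in
`SL(2,ℍ)`. -/
theorem formEquiv_of_isQuaternionic {Q G : Matrix (Fin 4) (Fin 4) ℂ} (hG : IsQuaternionic G)
    (h0 : G.det ≠ 0) {γ : ℂ} (hγ : γ ≠ 0) : FormEquiv Q (γ • (Gᵀ * Q * G)) := by
  obtain ⟨d, hd, hd'⟩ := hG.exists_det
  have hdp : 0 < d := lt_of_le_of_ne hd fun h => h0 (by rw [hd', ← h]; simp)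
  obtain ⟨t, ht, htd⟩ : ∃ t : ℝ, 0 < t ∧ t ^ 4 * d = 1 := by
    refine ⟨(d ^ (1 / 4 : ℝ))⁻¹, by positivity, ?_⟩
    rw [inv_pow, ← Real.rpow_natCast, ← Real.rpow_mul hdp.le]
    norm_num
    field_simp
  have htC : (t : ℂ) ≠ 0 := by exact_mod_cast ht.ne'
  refine ⟨(t : ℂ) • G, ⟨hG.smul t, ?_⟩, γ / t ^ 2, by positivity, ?_⟩
  · rw [Matrix.det_smul, hd', Fintype.card_fin]
    exact_mod_cast htd
  · simp only [Matrix.transpose_smul, Matrix.smul_mul, Matrix.mul_smul, smul_smul]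
    congr 1
    field_simp

theorem formEquiv_smul (Q : Matrix (Fin 4) (Fin 4) ℂ) {γ : ℂ} (hγ : γ ≠ 0) :
    FormEquiv Q (γ • Q) := by
  simpa using formEquiv_of_isQuaternionic (Q := Q) IsQuaternionic.one (by simp) hγ

theorem FormEquiv.refl (Q : Matrix (Fin 4) (Fin 4) ℂ) : FormEquiv Q Q := by
  simpa using formEquiv_smul Q one_ne_zero

/-- `Q` is equivalent to every matrix that is, up to scale, its Gram matrix in a basis
`u, uj, w, wj`. -/
theorem formEquiv_of_gram {Q T : Matrix (Fin 4) (Fin 4) ℂ} (hQ : Q.IsSymm) (hT : T.IsSymm)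
    {u w : Fin 4 → ℂ} (hd : (frame u w).det ≠ 0) {γ : ℂ} (hγ : γ ≠ 0)
    (h00 : γ * bil Q u u = T 0 0) (h01 : γ * bil Q u (rightJ u) = T 0 1)
    (h02 : γ * bil Q u w = T 0 2) (h03 : γ * bil Q u (rightJ w) = T 0 3)
    (h11 : γ * bil Q (rightJ u) (rightJ u) = T 1 1) (h12 : γ * bil Q (rightJ u) w = T 1 2)
    (h13 : γ * bil Q (rightJ u) (rightJ w) = T 1 3) (h22 : γ * bil Q w w = T 2 2)
    (h23 : γ * bil Q w (rightJ w) = T 2 3) (h33 : γ * bil Q (rightJ w) (rightJ w) = T 3 3) :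
    FormEquiv Q T := by
  convert formEquiv_of_isQuaternionic (isQuaternionic_frame u w) hd hγ using 1
  have e : ∀ i, frame u w *ᵥ Pi.single i 1 = ![u, rightJ u, w, rightJ w] i := fun i => by
    rw [frame_mulVec]; fin_cases i <;> simp
  ext i k
  rw [← bil_single (γ • _), bil_smul_matrix, bil_congr_matrix, e, e]
  fin_cases i <;> fin_cases k <;> simp [*] <;>
    rw [bil_comm _ _ hQ, ← hT.apply] <;> simp [*]

/-! ### Quadrics and their forms -/

theorem mk_mem_quadric {Q : Matrix (Fin 4) (Fin 4) ℂ} {v : Fin 4 → ℂ} (hv : v ≠ 0) :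
    Projectivization.mk ℂ v hv ∈ quadric Q ↔ bil Q v v = 0 := by
  simp only [quadric, Set.mem_ofPred_eq, Projectivization.submodule_mk]
  constructor
  · intro h
    exact h v (Submodule.mem_span_singleton_self v)
  · intro h w hw
    obtain ⟨c, rfl⟩ := Submodule.mem_span_singleton.1 hw
    change bil Q (c • v) (c • v) = 0
    simp [h]

theorem quadric_smul (Q : Matrix (Fin 4) (Fin 4) ℂ) {γ : ℂ} (hγ : γ ≠ 0) :
    quadric (γ • Q) = quadric Q := by
  ext p
  induction p using Projectivization.ind with | h v hv => ?_
  rw [mk_mem_quadric, mk_mem_quadric, bil_smul_matrix, mul_eq_zero, or_iff_right hγ]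

theorem ext_bil_self {Q Q' : Matrix (Fin 4) (Fin 4) ℂ} (hQ : Q.IsSymm) (hQ' : Q'.IsSymm)
    (h : ∀ v, bil Q v v = bil Q' v v) : Q = Q' := by
  refine ext_bil fun u v => ?_
  have := h (u + v)
  simp only [bil_add_left, bil_add_right, h u, h v, bil_comm v u hQ, bil_comm v u hQ'] at this
  linear_combination this / 2

theorem exists_bil_self_ne_zero {Q : Matrix (Fin 4) (Fin 4) ℂ} (hQ : Q.IsSymm) (h0 : Q.det ≠ 0) :
    ∃ w, bil Q w w ≠ 0 := by
  by_contra! h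
  refine h0 ?_
  rw [ext_bil_self hQ (Q' := 0) Matrix.isSymm_zero fun v => by rw [h]; simp [bil]]
  simp

/-- Monic quadratic polynomials with the same set of roots have the same constant coefficient: a
single root is a double root. -/
theorem quadratic_coeff_eq {b c b' c' : ℂ}
    (h : ∀ t : ℂ, t ^ 2 + b * t + c = 0 ↔ t ^ 2 + b' * t + c' = 0) : c = c' := by
  have key : ∀ b c : ℂ, ∃ r s : ℂ, b = -(r + s) ∧ c = r * s := fun b c => by
    obtain ⟨d, hd⟩ := IsAlgClosed.exists_pow_nat_eq (b ^ 2 - 4 * c) two_pos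
    exact ⟨(-b + d) / 2, (-b - d) / 2, by ring, by linear_combination hd / 4⟩
  obtain ⟨r, s, rfl, rfl⟩ := key b c
  obtain ⟨r', s', rfl, rfl⟩ := key b' c'
  have h' : ∀ t, (t - r) * (t - s) = 0 ↔ (t - r') * (t - s') = 0 := fun t => by
    rw [show (t - r) * (t - s) = t ^ 2 + -(r + s) * t + r * s by ring,
      show (t - r') * (t - s') = t ^ 2 + -(r' + s') * t + r' * s' by ring]
    exact h t
  simp only [mul_eq_zero, sub_eq_zero] at h'
  have h1 := h' r
  have h2 := h' s
  have h3 := h' r'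
  have h4 := h' s'
  clear key h h'
  grind

/-- A quadric determines its form up to scale. -/
theorem exists_smul_of_quadric_eq {Q Q' : Matrix (Fin 4) (Fin 4) ℂ} (hQ : Q.IsSymm)
    (hQ' : Q'.IsSymm) (h0 : Q.det ≠ 0) (h : quadric Q = quadric Q') :
    ∃ γ : ℂ, γ ≠ 0 ∧ Q' = γ • Q := by
  have hz : ∀ v, bil Q v v = 0 ↔ bil Q' v v = 0 := fun v => by
    by_cases hv : v = 0
    · simp [hv]
    · rw [← mk_mem_quadric hv, ← mk_mem_quadric hv, h]
  obtain ⟨w, hw⟩ := exists_bil_self_ne_zero hQ h0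
  have hw' : bil Q' w w ≠ 0 := fun h => hw ((hz w).2 h)
  refine ⟨bil Q' w w / bil Q w w, div_ne_zero hw' hw, ?_⟩
  refine ext_bil_self hQ' (by rw [Matrix.IsSymm, Matrix.transpose_smul, hQ.eq]) fun v => ?_
  -- compare the restrictions of both forms to the line `v + t w`
  have hl : ∀ (P : Matrix (Fin 4) (Fin 4) ℂ), P.IsSymm → bil P w w ≠ 0 → ∀ t : ℂ,
      t ^ 2 + (2 * bil P v w / bil P w w) * t + bil P v v / bil P w w = 0 ↔
        bil P (v + t • w) (v + t • w) = 0 := fun P hP hPw t => by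
    simp only [bil_add_left, bil_add_right, bil_smul_left, bil_smul_right, bil_comm w v hP]
    field_simp
    ring_nf
  have := quadratic_coeff_eq fun t => (hl Q hQ hw t).trans ((hz _).trans (hl Q' hQ' hw' t).symm)
  rw [bil_smul_matrix]
  field_simp at this ⊢
  linear_combination -this

theorem map_image_quadric (F : (Fin 4 → ℂ) ≃ₗ[ℂ] (Fin 4 → ℂ)) {Q Q' : Matrix (Fin 4) (Fin 4) ℂ}
    (h : ∀ v, bil Q' (F v) (F v) = bil Q v v) :
    Projectivization.map F.toLinearMap F.injective '' quadric Q = quadric Q' := by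
  ext p
  induction p using Projectivization.ind with | h v hv => ?_
  constructor
  · rintro ⟨q, hq, hqp⟩
    induction q using Projectivization.ind with | h w hw => ?_
    rw [← hqp, Projectivization.map_mk, mk_mem_quadric]
    rw [mk_mem_quadric] at hq
    exact (h w).trans hq
  · intro hp
    have hv' : F.symm v ≠ 0 := by simpa using hv
    refine ⟨Projectivization.mk ℂ (F.symm v) hv', ?_, ?_⟩
    · rw [mk_mem_quadric] at hp ⊢
      rw [← h, F.apply_symm_apply, hp]
    · rw [Projectivization.map_mk]
      simp

/-! ### Maps covering a conformal transformation -/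

theorem twistorVec_rightJ (v : Fin 4 → ℂ) : twistorVec (rightJ v) = twistorVec v := by
  rw [twistorVec_apply, twistorVec_apply]
  ext i
  fin_cases i <;> simp [Complex.normSq_apply] <;> ring

/-- A map that covers a transformation of `S⁴` maps quaternionic lines to quaternionic lines. -/
theorem Covers.apply_rightJ {F : (Fin 4 → ℂ) ≃ₗ[ℂ] (Fin 4 → ℂ)} {φ : Matrix (Fin 6) (Fin 6) ℝ}
    (h : Covers F φ) (v : Fin 4 → ℂ) : ∃ a b : ℂ, F (rightJ v) = a • F v + b • rightJ (F v) := by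
  by_cases hv : v = 0
  · exact ⟨0, 0, by simp [hv]⟩
  refine exists_eq_of_det_frame_eq_zero (by simpa using hv) ?_
  obtain ⟨r, hr, h1⟩ := h v
  obtain ⟨s, hs, h2⟩ := h (rightJ v)
  have h3 : twistorVec (F (rightJ v)) = (s / r) • twistorVec (F v) := by
    rw [h2, h1, twistorVec_rightJ, smul_smul, div_mul_cancel₀ _ hr.ne']
  have h4 : lor (twistorVec (F v)) (twistorVec (F (rightJ v))) = 0 := by
    rw [h3, lor, Matrix.mulVec_smul, dotProduct_smul, ← lor, lor_twistorVec_self, smul_zero]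
  rw [det_frame, h4]
  simp

/-- A complex linear map that preserves every quaternionic line, by mapping `v` into the line of
`v`, is a scalar. -/
theorem eq_scalar_of_forall_mem_span {L : Matrix (Fin 4) (Fin 4) ℂ}
    (h : ∀ v, ∃ a b : ℂ, L *ᵥ v = a • v + b • rightJ v) : L = L 0 0 • 1 := by
  obtain ⟨a0, b0, h0⟩ := h ![1, 0, 0, 0]
  obtain ⟨a1, b1, h1⟩ := h ![0, 1, 0, 0]
  obtain ⟨a2, b2, h2⟩ := h ![0, 0, 1, 0]
  obtain ⟨a3, b3, h3⟩ := h ![0, 0, 0, 1]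
  obtain ⟨a4, b4, h4⟩ := h ![1, 0, 1, 0]
  obtain ⟨a5, b5, h5⟩ := h ![0, 1, 0, 1]
  obtain ⟨a6, b6, h6⟩ := h ![1, 0, Complex.I, 0]
  obtain ⟨a7, b7, h7⟩ := h ![0, 1, 0, Complex.I]
  obtain ⟨a8, b8, h8⟩ := h ![1, 0, 0, 1]
  simp only [funext_iff, Fin.forall_fin_succ, IsEmpty.forall_iff, and_true]
    at h0 h1 h2 h3 h4 h5 h6 h7 h8
  simp [Matrix.mulVec, dotProduct, Fin.sum_univ_four] at h0 h1 h2 h3 h4 h5 h6 h7 h8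
  have hI := Complex.I_ne_zero
  clear h
  ext i k
  fin_cases i <;> fin_cases k <;> simp <;> grind

/-- A map that covers a transformation of `S⁴` is a complex multiple of a quaternionic map. -/
theorem Covers.exists_isQuaternionic {F : (Fin 4 → ℂ) ≃ₗ[ℂ] (Fin 4 → ℂ)}
    {φ : Matrix (Fin 6) (Fin 6) ℝ} (h : Covers F φ) :
    ∃ (z : ℂ) (G : Matrix (Fin 4) (Fin 4) ℂ), z ≠ 0 ∧ IsQuaternionic G ∧ G.det ≠ 0 ∧
      ∀ v, G *ᵥ v = z • F v := by
  -- `v ↦ j F j F⁻¹ v` maps every vector into its own quaternionic line, hence is a scalar `c`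
  let L : (Fin 4 → ℂ) →ₗ[ℂ] (Fin 4 → ℂ) :=
    { toFun := fun v => rightJ (F (rightJ (F.symm v)))
      map_add' := fun u v => by simp
      map_smul' := fun c v => by simp }
  have hL : ∀ v, ∃ a b : ℂ, LinearMap.toMatrix' L *ᵥ v = a • v + b • rightJ v := fun v => by
    obtain ⟨a, b, hab⟩ := h.apply_rightJ (F.symm v)
    refine ⟨-conj b, conj a, ?_⟩
    rw [LinearMap.toMatrix'_mulVec]
    change rightJ (F (rightJ (F.symm v))) = _
    rw [hab]
    simp only [F.apply_symm_apply, rightJ_add, rightJ_smul, rightJ_rightJ]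
    module
  have hc := eq_scalar_of_forall_mem_span hL
  set c := LinearMap.toMatrix' L 0 0
  have hF : ∀ v, rightJ (F (rightJ v)) = c • F v := fun v => by
    have : L (F v) = c • F v := by
      rw [← LinearMap.toMatrix'_mulVec, hc, Matrix.smul_mulVec, Matrix.one_mulVec]
    rw [← this]
    change _ = rightJ (F (rightJ (F.symm (F v))))
    rw [F.symm_apply_apply]
  have hF' : ∀ v, F (rightJ v) = -(conj c • rightJ (F v)) := fun v => by
    rw [← rightJ_smul, ← hF, rightJ_rightJ, neg_neg]
  have hcc : c * conj c = 1 := by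
    have hne : F (Pi.single 0 1) ≠ 0 := by simp
    have h1 : F (Pi.single 0 1) = (c * conj c) • F (Pi.single 0 1) := by
      have := hF' (rightJ (Pi.single 0 1))
      rw [rightJ_rightJ, map_neg, neg_inj, hF, smul_smul, mul_comm] at this
      exact this
    by_contra hne1
    have h2 : (c * conj c - 1) • F (Pi.single 0 1) = 0 := by
      rw [sub_smul, ← h1, one_smul, sub_self]
    exact hne ((smul_eq_zero.1 h2).resolve_left (sub_ne_zero.2 hne1))
  obtain ⟨z, hz⟩ := IsAlgClosed.exists_pow_nat_eq (-c) two_pos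
  have hz0 : z ≠ 0 := by
    rintro rfl
    have : c = 0 := by simpa using hz.symm
    simp [this] at hcc
  have hzz : z * conj z = 1 := by
    rw [Complex.mul_conj] at hcc ⊢
    have h1 : Complex.normSq z ^ 2 = 1 := by
      rw [← map_pow, hz, Complex.normSq_neg]
      exact_mod_cast hcc
    have h2 := (pow_eq_one_iff_of_nonneg (Complex.normSq_nonneg z) two_ne_zero).1 h1
    rw [h2, Complex.ofReal_one]
  have hzc : -(z * conj c) = conj z := by
    have : z * (-(z * conj c) - conj z) = 0 := by
      linear_combination (-conj c) * hz + hcc - hzz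
    exact sub_eq_zero.1 ((mul_eq_zero.1 this).resolve_left hz0)
  have hG : ∀ v, (z • LinearMap.toMatrix' F.toLinearMap) *ᵥ v = z • F v := fun v => by
    rw [Matrix.smul_mulVec, LinearMap.toMatrix'_mulVec]
    rfl
  refine ⟨z, z • LinearMap.toMatrix' F.toLinearMap, hz0, isQuaternionic_iff.2 fun v => ?_, ?_, hG⟩
  · rw [hG, hG, hF', rightJ_smul, ← hzc]
    module
  · intro h0
    obtain ⟨v, hv, hv0⟩ := Matrix.exists_mulVec_eq_zero_iff.2 h0
    rw [hG, smul_eq_zero, or_iff_right hz0] at hv0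
    exact hv (by simpa using hv0)

theorem ConfEquiv.formEquiv {Q Q' : Matrix (Fin 4) (Fin 4) ℂ} (hQ : Q.IsSymm) (hQ' : Q'.IsSymm)
    (h0 : Q.det ≠ 0) (h : ConfEquiv (quadric Q) (quadric Q')) : FormEquiv Q Q' := by
  obtain ⟨φ, -, F, hF, hS⟩ := h
  obtain ⟨z, G, hz, hG, hG0, hGF⟩ := hF.exists_isQuaternionic
  have hG' : G⁻¹.det ≠ 0 := by simpa [Matrix.det_nonsing_inv] using hG0
  have hu : IsUnit G.det := isUnit_iff_ne_zero.2 hG0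
  have h1 : FormEquiv Q (G⁻¹ᵀ * Q * G⁻¹) := by
    simpa using formEquiv_of_isQuaternionic (Q := Q) (hG.inv hG0) hG' one_ne_zero
  have h2 : quadric (G⁻¹ᵀ * Q * G⁻¹) = quadric Q' := by
    rw [← hS, ← quadric_smul (G⁻¹ᵀ * Q * G⁻¹) (γ := z ^ 2) (by positivity)]
    refine (map_image_quadric F fun v => ?_).symm
    have h3 : G⁻¹ *ᵥ (z • F v) = v := by
      rw [← hGF, Matrix.mulVec_mulVec, Matrix.nonsing_inv_mul _ hu, Matrix.one_mulVec]
    calc bil (z ^ 2 • (G⁻¹ᵀ * Q * G⁻¹)) (F v) (F v)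
        = bil (G⁻¹ᵀ * Q * G⁻¹) (z • F v) (z • F v) := by
          rw [bil_smul_matrix, bil_smul_left, bil_smul_right]; ring
      _ = bil Q v v := by rw [bil_congr_matrix, h3]
  obtain ⟨γ, hγ, rfl⟩ := exists_smul_of_quadric_eq
    (by rw [Matrix.IsSymm, Matrix.transpose_mul, Matrix.transpose_mul, hQ.eq,
      Matrix.transpose_transpose, Matrix.mul_assoc]) hQ'
    (by rw [Matrix.det_mul, Matrix.det_mul, Matrix.det_transpose]
        exact mul_ne_zero (mul_ne_zero hG' h0) hG') h2
  exact h1.trans (formEquiv_smul _ hγ)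

/-! ### The conformal transformation of a quaternionic matrix -/

/-- The quaternionic Hermitian matrix with coordinates `x`, normalized so that the coordinates of
`v v^† + (vj)(vj)^†` are those of `twistorVec v`. -/
def herm (x : Fin 6 → ℝ) : Matrix (Fin 4) (Fin 4) ℂ :=
  !![((x 0 + x 1) / 2 : ℝ), 0,
       ((x 2 - Complex.I * x 3) / 2 : ℂ), ((x 4 + Complex.I * x 5) / 2 : ℂ);
     0, ((x 0 + x 1) / 2 : ℝ),
       (-(x 4 - Complex.I * x 5) / 2 : ℂ), ((x 2 + Complex.I * x 3) / 2 : ℂ);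
     ((x 2 + Complex.I * x 3) / 2 : ℂ), (-(x 4 + Complex.I * x 5) / 2 : ℂ),
       ((x 0 - x 1) / 2 : ℝ), 0;
     ((x 4 - Complex.I * x 5) / 2 : ℂ), ((x 2 - Complex.I * x 3) / 2 : ℂ),
       0, ((x 0 - x 1) / 2 : ℝ)]

/-- The coordinates in `ℝ^{1,5}` of a quaternionic Hermitian matrix. On other matrices the value has
no meaning. -/
def hermCoord (M : Matrix (Fin 4) (Fin 4) ℂ) : Fin 6 → ℝ :=
  ![(M 0 0 + M 2 2).re, (M 0 0 - M 2 2).re, 2 * (M 2 0).re, 2 * (M 2 0).im, 2 * (M 3 0).re,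
    -2 * (M 3 0).im]

/-- The quaternionic Hermitian matrix `v v^† + (vj)(vj)^†`. -/
def moment (v : Fin 4 → ℂ) : Matrix (Fin 4) (Fin 4) ℂ :=
  Matrix.vecMulVec v (star v) + Matrix.vecMulVec (rightJ v) (star (rightJ v))

theorem hermCoord_moment (v : Fin 4 → ℂ) : hermCoord (moment v) = twistorVec v := by
  rw [twistorVec_apply]
  ext i
  fin_cases i <;> simp [hermCoord, moment, Matrix.vecMulVec, Complex.normSq_apply] <;> ring

theorem herm_twistorVec (v : Fin 4 → ℂ) : herm (twistorVec v) = moment v := by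
  rw [twistorVec_apply]
  ext i k
  fin_cases i <;> fin_cases k <;> apply Complex.ext <;>
    simp [herm, moment, Matrix.vecMulVec, Complex.normSq_apply] <;> ring

theorem moment_mulVec {G : Matrix (Fin 4) (Fin 4) ℂ} (hG : IsQuaternionic G) (v : Fin 4 → ℂ) :
    moment (G *ᵥ v) = G * moment v * Gᴴ := by
  rw [moment, ← hG.mulVec_rightJ, Matrix.star_mulVec, Matrix.star_mulVec, moment, Matrix.mul_add,
    Matrix.add_mul, Matrix.mul_vecMulVec, Matrix.mul_vecMulVec, Matrix.vecMulVec_mul,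
    Matrix.vecMulVec_mul]

/-- The action `X ↦ G X G^†` of `G` on quaternionic Hermitian matrices, as a matrix on `ℝ^{1,5}`. -/
def hermLin (G : Matrix (Fin 4) (Fin 4) ℂ) : Matrix (Fin 6) (Fin 6) ℝ :=
  LinearMap.toMatrix'
    { toFun := fun x => hermCoord (G * herm x * Gᴴ)
      map_add' := fun x y => by
        have h1 : herm (x + y) = herm x + herm y := by
          ext i k; fin_cases i <;> fin_cases k <;> simp [herm] <;> ring
        rw [h1, Matrix.mul_add, Matrix.add_mul]
        ext i; fin_cases i <;> simp [hermCoord] <;> ring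
      map_smul' := fun c x => by
        have h1 : herm (c • x) = (c : ℂ) • herm x := by
          ext i k; fin_cases i <;> fin_cases k <;> simp [herm] <;> ring
        rw [h1, Matrix.mul_smul, Matrix.smul_mul]
        ext i; fin_cases i <;> simp [hermCoord] <;> ring }

theorem hermLin_mulVec_twistorVec {G : Matrix (Fin 4) (Fin 4) ℂ} (hG : IsQuaternionic G)
    (v : Fin 4 → ℂ) : hermLin G *ᵥ twistorVec v = twistorVec (G *ᵥ v) := by
  rw [hermLin, LinearMap.toMatrix'_mulVec]
  change hermCoord (G * herm (twistorVec v) * Gᴴ) = _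
  rw [herm_twistorVec, ← moment_mulVec hG, hermCoord_moment]

theorem continuous_hermLin : Continuous hermLin := by
  have h1 : Continuous hermCoord := by
    refine continuous_pi fun i => ?_
    fin_cases i <;> simp [hermCoord] <;> fun_prop
  refine continuous_matrix fun i k => ?_
  simp only [hermLin, LinearMap.toMatrix'_apply]
  change Continuous fun G : Matrix (Fin 4) (Fin 4) ℂ =>
    hermCoord (G * herm (Pi.single k 1) * Gᴴ) i
  exact (continuous_apply i).comp (h1.comp (by fun_prop))

/-- The light cone spans `ℝ^{1,5}`. -/
theorem eq_zero_of_mulVec_twistorVec {C : Matrix (Fin 6) (Fin 6) ℝ}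
    (h : ∀ v, C *ᵥ twistorVec v = 0) : C = 0 := by
  have h0 := h ![1, 0, 0, 0]
  have h1 := h ![0, 0, 1, 0]
  have h2 := h ![1, 0, 1, 0]
  have h3 := h ![1, 0, Complex.I, 0]
  have h4 := h ![1, 0, 0, 1]
  have h5 := h ![1, 0, 0, Complex.I]
  simp only [twistorVec_apply] at h0 h1 h2 h3 h4 h5
  ext i k
  have e0 := congrFun h0 i
  have e1 := congrFun h1 i
  have e2 := congrFun h2 i
  have e3 := congrFun h3 i
  have e4 := congrFun h4 i
  have e5 := congrFun h5 i
  simp [Matrix.mulVec, dotProduct, Fin.sum_univ_six] at e0 e1 e2 e3 e4 e5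
  fin_cases k <;> simp <;> linarith

theorem ext_mulVec_twistorVec {A B : Matrix (Fin 6) (Fin 6) ℝ}
    (h : ∀ v, A *ᵥ twistorVec v = B *ᵥ twistorVec v) : A = B :=
  sub_eq_zero.1 <| eq_zero_of_mulVec_twistorVec fun v => by rw [Matrix.sub_mulVec, h, sub_self]

theorem ext_dotProduct_twistorVec {A B : Matrix (Fin 6) (Fin 6) ℝ}
    (h : ∀ u v, twistorVec u ⬝ᵥ (A *ᵥ twistorVec v) = twistorVec u ⬝ᵥ (B *ᵥ twistorVec v)) :
    A = B := by
  refine ext_mulVec_twistorVec fun v => ?_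
  have : Matrix.of (fun _ : Fin 6 => A *ᵥ twistorVec v - B *ᵥ twistorVec v) = 0 := by
    refine eq_zero_of_mulVec_twistorVec fun u => ?_
    ext i
    have := h u v
    simp only [Matrix.mulVec, Matrix.of_apply, Pi.zero_apply]
    rw [dotProduct_comm, dotProduct_sub]
    exact sub_eq_zero.2 this
  have h0 := congrFun this 0
  exact sub_eq_zero.1 h0

theorem mul_frame {G : Matrix (Fin 4) (Fin 4) ℂ} (hG : IsQuaternionic G) (u w : Fin 4 → ℂ) :
    G * frame u w = frame (G *ᵥ u) (G *ᵥ w) := by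
  refine Matrix.mulVec_injective (funext fun x => ?_)
  rw [← Matrix.mulVec_mulVec, frame_mulVec, frame_mulVec]
  simp only [Matrix.mulVec_add, Matrix.mulVec_smul, hG.mulVec_rightJ]

theorem IsQuaternionic.det_re_pos {G : Matrix (Fin 4) (Fin 4) ℂ} (hG : IsQuaternionic G)
    (h0 : G.det ≠ 0) : 0 < G.det.re := by
  obtain ⟨d, hd, hd'⟩ := hG.exists_det
  rw [hd'] at h0 ⊢
  exact lt_of_le_of_ne hd fun h => h0 (by rw [Complex.ofReal_eq_zero]; exact h.symm)

theorem IsQuaternionic.det_eq_re {G : Matrix (Fin 4) (Fin 4) ℂ} (hG : IsQuaternionic G) :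
    G.det = (G.det.re : ℂ) := by
  obtain ⟨d, -, hd⟩ := hG.exists_det
  rw [hd, Complex.ofReal_re]

/-! ### The conformal transformation is Lorentzian -/

theorem lor_twistorVec_mulVec {G : Matrix (Fin 4) (Fin 4) ℂ} (hG : IsQuaternionic G)
    (u w : Fin 4 → ℂ) : lor (twistorVec (G *ᵥ u)) (twistorVec (G *ᵥ w)) =
      G.det.re * lor (twistorVec u) (twistorVec w) := by
  have h := congrArg Matrix.det (mul_frame hG u w)
  rw [Matrix.det_mul, det_frame, det_frame, hG.det_eq_re, ← Complex.ofReal_mul,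
    Complex.ofReal_inj] at h
  linarith

/-- The Lorentz transformation covered by `G`, that is, the action of `G` on quaternionic Hermitian
matrices divided by `√(det G)`. It is only meaningful for invertible quaternionic matrices. -/
def conf (G : Matrix (Fin 4) (Fin 4) ℂ) : Matrix (Fin 6) (Fin 6) ℝ :=
  (√G.det.re)⁻¹ • hermLin G

theorem conf_mulVec_twistorVec {G : Matrix (Fin 4) (Fin 4) ℂ} (hG : IsQuaternionic G)
    (v : Fin 4 → ℂ) : conf G *ᵥ twistorVec v = (√G.det.re)⁻¹ • twistorVec (G *ᵥ v) := by
  rw [conf, Matrix.smul_mulVec, hermLin_mulVec_twistorVec hG]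

theorem conf_mem_O15 {G : Matrix (Fin 4) (Fin 4) ℂ} (hG : IsQuaternionic G) (h0 : G.det ≠ 0) :
    conf G ∈ O15 := by
  have hd := hG.det_re_pos h0
  refine ext_dotProduct_twistorVec fun u v => ?_
  rw [Matrix.mul_assoc, ← Matrix.mulVec_mulVec, Matrix.dotProduct_mulVec, Matrix.vecMul_transpose,
    ← Matrix.mulVec_mulVec, conf_mulVec_twistorVec hG, conf_mulVec_twistorVec hG,
    Matrix.mulVec_smul, smul_dotProduct, dotProduct_smul, ← lor, ← lor,
    lor_twistorVec_mulVec hG, smul_eq_mul, smul_eq_mul]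
  have : (√G.det.re)⁻¹ * (√G.det.re)⁻¹ * G.det.re = 1 := by
    rw [← mul_inv, Real.mul_self_sqrt hd.le, inv_mul_cancel₀ hd.ne']
  linear_combination lor (twistorVec u) (twistorVec v) * this

theorem conf_one : conf 1 = 1 := ext_mulVec_twistorVec fun v => by
  rw [conf_mulVec_twistorVec IsQuaternionic.one]
  simp

/-! ### Connectedness of the quaternionic linear group -/

/-- A segment of invertible quaternionic matrices gives a path in `O(1,5)`, so its end points have
conformal transformations in the same connected component. -/
theorem conf_mem_SO15_of_segment {u w u' w' : Fin 4 → ℂ}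
    (h : ∀ t ∈ Set.Icc (0 : ℝ) 1, (frame (((1 - t : ℝ) : ℂ) • u + (t : ℂ) • u')
      (((1 - t : ℝ) : ℂ) • w + (t : ℂ) • w')).det ≠ 0)
    (h' : conf (frame u' w') ∈ SO15) : conf (frame u w) ∈ SO15 := by
  let g : ℝ → Matrix (Fin 4) (Fin 4) ℂ := fun t =>
    frame (((1 - t : ℝ) : ℂ) • u + (t : ℂ) • u') (((1 - t : ℝ) : ℂ) • w + (t : ℂ) • w')
  have hgc : Continuous g := by
    have : g = fun t : ℝ => ((1 - t : ℝ) : ℂ) • frame u w + (t : ℂ) • frame u' w' := by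
      funext t
      refine Matrix.mulVec_injective (funext fun x => ?_)
      simp only [g, frame_mulVec, Matrix.add_mulVec, Matrix.smul_mulVec, rightJ_add, rightJ_smul,
        Complex.conj_ofReal]
      module
    rw [this]
    fun_prop
  have hg0 : g 0 = frame u w := by simp [g]
  have hg1 : g 1 = frame u' w' := by simp [g]
  have hdet : Continuous fun t => (g t).det.re := Complex.continuous_re.comp hgc.matrix_det
  have hc : ContinuousOn (fun t => conf (g t)) (Set.Icc 0 1) := by
    refine ContinuousOn.smul (ContinuousOn.inv₀ (Real.continuous_sqrt.comp hdet).continuousOn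
      fun t ht => ?_) (continuous_hermLin.comp hgc).continuousOn
    exact (Real.sqrt_pos.2 ((isQuaternionic_frame _ _).det_re_pos (h t ht))).ne'
  have hpre := isPreconnected_Icc.image _ hc
  have hsub : (fun t => conf (g t)) '' Set.Icc (0 : ℝ) 1 ⊆ O15 := by
    rintro _ ⟨t, ht, rfl⟩
    exact conf_mem_O15 (isQuaternionic_frame _ _) (h t ht)
  have := hpre.subset_connectedComponentIn ⟨1, by simp, rfl⟩ hsub ⟨0, by simp, rfl⟩
  simp only [hg0, hg1] at this
  rw [SO15] at h' ⊢
  rwa [connectedComponentIn_eq h']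

theorem det_frame_comb_left (u w : Fin 4 → ℂ) (a b c d : ℂ) :
    (frame (a • u + b • rightJ u + c • w + d • rightJ w) w).det =
      ((Complex.normSq a + Complex.normSq b : ℝ) : ℂ) * (frame u w).det := by
  have h := mul_frame (isQuaternionic_frame u w) ![a, b, c, d] ![0, 0, 1, 0]
  rw [frame_mulVec, frame_mulVec] at h
  have h2 : (frame ![a, b, c, d] ![0, 0, 1, 0]).det =
      ((Complex.normSq a + Complex.normSq b : ℝ) : ℂ) := by
    rw [det_frame, lor_apply, twistorVec_apply, twistorVec_apply]
    simp
    ring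
  rw [← h2, mul_comm, ← Matrix.det_mul, h]
  simp

theorem det_frame_comb_right (u w : Fin 4 → ℂ) (a b c d : ℂ) :
    (frame u (c • u + d • rightJ u + a • w + b • rightJ w)).det =
      ((Complex.normSq a + Complex.normSq b : ℝ) : ℂ) * (frame u w).det := by
  have h := mul_frame (isQuaternionic_frame u w) ![1, 0, 0, 0] ![c, d, a, b]
  rw [frame_mulVec, frame_mulVec] at h
  have h2 : (frame ![1, 0, 0, 0] ![c, d, a, b]).det =
      ((Complex.normSq a + Complex.normSq b : ℝ) : ℂ) := by
    rw [det_frame, lor_apply, twistorVec_apply, twistorVec_apply]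
    simp
  rw [← h2, mul_comm, ← Matrix.det_mul, h]
  simp

/-- For a nonzero quaternion with components `a`, `b`, the segment to `1` from it or from its
multiple by `i` avoids zero: only negative real numbers are joined to `1` through zero. -/
theorem segment_ne_zero {a b : ℂ} (hab : a ≠ 0 ∨ b ≠ 0) :
    (∀ t ∈ Set.Icc (0 : ℝ) 1, (((1 - t : ℝ) : ℂ) * a + t ≠ 0 ∨ ((1 - t : ℝ) : ℂ) * b ≠ 0)) ∨
    (∀ t ∈ Set.Icc (0 : ℝ) 1,
      (((1 - t : ℝ) : ℂ) * (Complex.I * a) + t ≠ 0 ∨ ((1 - t : ℝ) : ℂ) * (Complex.I * b) ≠ 0)) := by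
  by_contra! h
  obtain ⟨⟨t, ⟨ht0, ht1⟩, h1, h2⟩, ⟨s, ⟨hs0, hs1⟩, h3, h4⟩⟩ := h
  have e1 := congrArg Complex.re h1
  have e2 := congrArg Complex.im h1
  have e3 := congrArg Complex.re h3
  have e4 := congrArg Complex.im h3
  simp at e1 e2 e3 e4
  have ht : 1 - t ≠ 0 := fun h => by rw [h] at e1; norm_num at e1; linarith
  have hs : 1 - s ≠ 0 := fun h => by rw [h] at e3; norm_num at e3; linarith
  have htc : ((1 - t : ℝ) : ℂ) ≠ 0 := by exact_mod_cast ht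
  have hb : b = 0 := (mul_eq_zero.1 h2).resolve_left htc
  have ha2 : a.im = 0 := e2.resolve_left ht
  have ha1 : a.re = 0 := e4.resolve_left hs
  exact hab.elim (fun h => h (Complex.ext ha1 ha2)) (fun h => h hb)

theorem segment_I_ne_zero (a : ℂ) (ha : a ≠ 0) (t : ℝ) :
    ((1 - t : ℝ) : ℂ) * a + t * (Complex.I * a) ≠ 0 := by
  rw [show ((1 - t : ℝ) : ℂ) * a + t * (Complex.I * a) =
    (((1 - t : ℝ) : ℂ) + t * Complex.I) * a by ring]
  refine mul_ne_zero (fun h => ?_) ha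
  have h1 := congrArg Complex.re h
  have h2 := congrArg Complex.im h
  simp at h1 h2
  rw [h2] at h1
  norm_num at h1

/-- The first vector of a frame may be changed freely, in one or two segments. -/
theorem conf_frame_mem_SO15_left {u u' w : Fin 4 → ℂ} (h : (frame u w).det ≠ 0)
    (h' : (frame u' w).det ≠ 0) (hS : conf (frame u' w) ∈ SO15) : conf (frame u w) ∈ SO15 := by
  obtain ⟨a, b, c, d, rfl⟩ := exists_eq_of_det_frame_ne_zero h' u
  rw [det_frame_comb_left] at h
  have hab : a ≠ 0 ∨ b ≠ 0 := by
    by_contra! h0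
    simp [h0.1, h0.2] at h
  have key : ∀ (a b c d : ℂ) (t : ℝ), (((1 - t : ℝ) : ℂ) * a + t ≠ 0 ∨ ((1 - t : ℝ) : ℂ) * b ≠ 0) →
      (frame (((1 - t : ℝ) : ℂ) • (a • u' + b • rightJ u' + c • w + d • rightJ w) + (t : ℂ) • u')
        (((1 - t : ℝ) : ℂ) • w + (t : ℂ) • w)).det ≠ 0 := fun a b c d t ht => by
    have := det_frame_comb_left u' w (((1 - t : ℝ) : ℂ) * a + t) (((1 - t : ℝ) : ℂ) * b)
      (((1 - t : ℝ) : ℂ) * c) (((1 - t : ℝ) : ℂ) * d)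
    convert mul_ne_zero (normSq_add_ne_zero ht) h' using 1
    rw [← this]
    congr 2
    · module
    · push_cast; module
  rcases segment_ne_zero hab with hs | hs
  · exact conf_mem_SO15_of_segment (fun t ht => key a b c d t (hs t ht)) hS
  · have := conf_mem_SO15_of_segment (fun t ht => key _ _ (Complex.I * c) (Complex.I * d) t
      (hs t ht)) hS
    refine conf_mem_SO15_of_segment (fun t ht => ?_) this
    have h2 := det_frame_comb_left u' w (((1 - t : ℝ) : ℂ) * a + t * (Complex.I * a))
      (((1 - t : ℝ) : ℂ) * b + t * (Complex.I * b)) (((1 - t : ℝ) : ℂ) * c + t * (Complex.I * c))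
      (((1 - t : ℝ) : ℂ) * d + t * (Complex.I * d))
    convert mul_ne_zero (normSq_add_ne_zero (hab.imp (fun h => segment_I_ne_zero a h t)
      (fun h => segment_I_ne_zero b h t))) h' using 1
    rw [← h2]
    congr 2
    · module
    · push_cast; module

/-- The second vector of a frame may be changed freely, in one or two segments. -/
theorem conf_frame_mem_SO15_right {u w w' : Fin 4 → ℂ} (h : (frame u w).det ≠ 0)
    (h' : (frame u w').det ≠ 0) (hS : conf (frame u w') ∈ SO15) : conf (frame u w) ∈ SO15 := by
  obtain ⟨c, d, a, b, rfl⟩ := exists_eq_of_det_frame_ne_zero h' w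
  rw [det_frame_comb_right] at h
  have hab : a ≠ 0 ∨ b ≠ 0 := by
    by_contra! h0
    simp [h0.1, h0.2] at h
  have key : ∀ (a b c d : ℂ) (t : ℝ), (((1 - t : ℝ) : ℂ) * a + t ≠ 0 ∨ ((1 - t : ℝ) : ℂ) * b ≠ 0) →
      (frame (((1 - t : ℝ) : ℂ) • u + (t : ℂ) • u) (((1 - t : ℝ) : ℂ) •
        (c • u + d • rightJ u + a • w' + b • rightJ w') + (t : ℂ) • w')).det ≠ 0 :=
      fun a b c d t ht => by
    have := det_frame_comb_right u w' (((1 - t : ℝ) : ℂ) * a + t) (((1 - t : ℝ) : ℂ) * b)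
      (((1 - t : ℝ) : ℂ) * c) (((1 - t : ℝ) : ℂ) * d)
    convert mul_ne_zero (normSq_add_ne_zero ht) h' using 1
    rw [← this]
    congr 2
    · push_cast; module
    · module
  rcases segment_ne_zero hab with hs | hs
  · exact conf_mem_SO15_of_segment (fun t ht => key a b c d t (hs t ht)) hS
  · have := conf_mem_SO15_of_segment (fun t ht => key _ _ (Complex.I * c) (Complex.I * d) t
      (hs t ht)) hS
    refine conf_mem_SO15_of_segment (fun t ht => ?_) this
    have h2 := det_frame_comb_right u w' (((1 - t : ℝ) : ℂ) * a + t * (Complex.I * a))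
      (((1 - t : ℝ) : ℂ) * b + t * (Complex.I * b)) (((1 - t : ℝ) : ℂ) * c + t * (Complex.I * c))
      (((1 - t : ℝ) : ℂ) * d + t * (Complex.I * d))
    convert mul_ne_zero (normSq_add_ne_zero (hab.imp (fun h => segment_I_ne_zero a h t)
      (fun h => segment_I_ne_zero b h t))) h' using 1
    rw [← h2]
    congr 2
    · push_cast; module
    · module

/-- Invertible quaternionic matrices are connected to `1`, so they cover elements of `SO_∘(1,5)`. -/
theorem conf_frame_mem_SO15 {u w : Fin 4 → ℂ} (h : (frame u w).det ≠ 0) :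
    conf (frame u w) ∈ SO15 := by
  have hone : frame ![1, 0, 0, 0] ![0, 0, 1, 0] = 1 := by
    ext i k; fin_cases i <;> fin_cases k <;> simp [frame]
  have hbase : conf (frame ![1, 0, 0, 0] ![0, 0, 1, 0]) ∈ SO15 := by
    rw [hone, conf_one]
    exact mem_connectedComponentIn (by simp [O15])
  have step : ∀ {u w : Fin 4 → ℂ}, (frame u w).det ≠ 0 → (frame ![1, 0, 0, 0] w).det ≠ 0 →
      conf (frame u w) ∈ SO15 := fun h h1 =>
    conf_frame_mem_SO15_left h h1 (conf_frame_mem_SO15_right h1 (by simp [hone]) hbase)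
  -- if `w` lies in the line of the first basis vector, then `u + w` does not
  by_cases h1 : (frame ![1, 0, 0, 0] w).det = 0
  · have e : u + w = (1 : ℂ) • u + (0 : ℂ) • rightJ u + (1 : ℂ) • w + (0 : ℂ) • rightJ w := by
      module
    have h2 : (frame u (u + w)).det ≠ 0 := by
      rw [e, det_frame_comb_right]
      simpa using h
    refine conf_frame_mem_SO15_right h h2 (step h2 fun h3 => h ?_)
    have hne : (![1, 0, 0, 0] : Fin 4 → ℂ) ≠ 0 := fun h => by simpa using congrFun h 0
    obtain ⟨a, b, hab⟩ := exists_eq_of_det_frame_eq_zero hne h1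
    obtain ⟨c, d, hcd⟩ := exists_eq_of_det_frame_eq_zero hne h3
    have hw2 : w 2 = 0 := by rw [hab, Pi.add_apply, Pi.smul_apply, Pi.smul_apply]; simp
    have hw3 : w 3 = 0 := by rw [hab, Pi.add_apply, Pi.smul_apply, Pi.smul_apply]; simp
    have hu2 : u 2 = 0 := by simpa [hw2] using congrFun hcd 2
    have hu3 : u 3 = 0 := by simpa [hw3] using congrFun hcd 3
    rw [det_frame, lor_apply, twistorVec_apply, twistorVec_apply]
    simp [hw2, hw3, hu2, hu3]
  · exact step h h1

/-! ### Equivalence of quadrics and of forms -/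

theorem FormEquiv.confEquiv {Q Q' : Matrix (Fin 4) (Fin 4) ℂ} (h : FormEquiv Q Q') :
    ConfEquiv (quadric Q) (quadric Q') := by
  obtain ⟨G, ⟨hG, hG1⟩, γ, hγ, rfl⟩ := h.symm
  have hG : IsQuaternionic G := hG
  have hu : IsUnit G.det := by simp [hG1]
  let F : (Fin 4 → ℂ) ≃ₗ[ℂ] (Fin 4 → ℂ) :=
    Matrix.toLinearEquiv' G (Matrix.invertibleOfIsUnitDet G hu)
  have hF : ∀ v, F v = G *ᵥ v := fun v => rfl
  refine ⟨conf G, ?_, F, fun v => ⟨1, one_pos, ?_⟩, ?_⟩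
  · rw [hG.eq_frame]
    exact conf_frame_mem_SO15 (by rw [← hG.eq_frame, hG1]; exact one_ne_zero)
  · rw [conf_mulVec_twistorVec hG, hG1, hF]
    simp
  · rw [quadric_smul _ hγ]
    refine map_image_quadric F fun v => ?_
    rw [hF, bil_congr_matrix]

theorem confEquiv_quadric_iff {Q Q' : Matrix (Fin 4) (Fin 4) ℂ} (hQ : Q.IsSymm) (hQ' : Q'.IsSymm)
    (h0 : Q.det ≠ 0) : ConfEquiv (quadric Q) (quadric Q') ↔ FormEquiv Q Q' :=
  ⟨fun h => h.formEquiv hQ hQ' h0, fun h => h.confEquiv⟩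

/-! ### Eigenvectors and chains of a form relative to its quaternionic conjugate -/

/-- `u` is an eigenvector, with eigenvalue `t`, of the conjugate form `Q* (u, v) = conj Q(uj, vj)`
relative to `Q`: it satisfies `Q* u = t Q u`. In contrast to the usual notion `u = 0` is allowed. -/
def IsEig (Q : Matrix (Fin 4) (Fin 4) ℂ) (t : ℂ) (u : Fin 4 → ℂ) : Prop :=
  ∀ v, bil Q (rightJ u) (rightJ v) = conj (t * bil Q u v)

/-- `u₁`, `u₂` is a Jordan chain of length 2 of `Q*` relative to `Q`, with eigenvalue `t`: it
satisfies `Q* u₁ = t Q u₁` and `Q* u₂ = t Q u₂ + Q u₁`. -/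
def IsChain (Q : Matrix (Fin 4) (Fin 4) ℂ) (t : ℂ) (u₁ u₂ : Fin 4 → ℂ) : Prop :=
  IsEig Q t u₁ ∧ ∀ v, bil Q (rightJ u₂) (rightJ v) = conj (t * bil Q u₂ v + bil Q u₁ v)

section eig
variable {Q : Matrix (Fin 4) (Fin 4) ℂ} {t : ℂ} {u v u₁ u₂ : Fin 4 → ℂ}

theorem IsEig.add (hu : IsEig Q t u) (hv : IsEig Q t v) : IsEig Q t (u + v) := fun w => by
  rw [rightJ_add, bil_add_left, bil_add_left, hu, hv, mul_add, map_add]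

theorem IsEig.smul (hu : IsEig Q t u) (c : ℂ) : IsEig Q t (c • u) := fun w => by
  rw [rightJ_smul, bil_smul_left, bil_smul_left, hu, ← map_mul, mul_left_comm]

/-- Right multiplication by `j` maps eigenvectors for `t` to eigenvectors for `t⁻¹` conjugated. -/
theorem IsEig.map_rightJ (hu : IsEig Q t u) (ht : t ≠ 0) :
    IsEig Q (conj t)⁻¹ (rightJ u) := fun w => by
  have h := hu (rightJ w)
  have ht' : conj t ≠ 0 := by simpa using ht
  rw [rightJ_rightJ, bil_neg_right] at h
  rw [rightJ_rightJ, bil_neg_left, ← neg_neg (bil Q (rightJ u) w), h]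
  simp
  field_simp

theorem isEig_smul_matrix {γ : ℂ} (hγ : γ ≠ 0) :
    IsEig (γ • Q) t u ↔ IsEig Q (t * (γ / conj γ)) u := by
  have hγ' : conj γ ≠ 0 := by simpa using hγ
  refine forall_congr' fun v => ?_
  simp only [bil_smul_matrix, map_mul, map_div₀, Complex.conj_conj]
  constructor <;> intro h
  · field_simp
    linear_combination h
  · rw [h]
    field_simp

theorem IsEig.ne_zero (hQ : Q.IsSymm) (h0 : Q.det ≠ 0) (hu : u ≠ 0) (h : IsEig Q t u) : t ≠ 0 := by
  rintro rfl
  refine hu (rightJ_eq_zero.1 (eq_zero_of_bil hQ h0 fun v => ?_))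
  have := h (-rightJ v)
  simpa using this

theorem IsChain.smul (h : IsChain Q t u₁ u₂) (c : ℂ) : IsChain Q t (c • u₁) (c • u₂) := by
  refine ⟨h.1.smul c, fun v => ?_⟩
  rw [rightJ_smul, bil_smul_left, h.2, bil_smul_left, bil_smul_left, ← map_mul]
  ring_nf

theorem IsChain.add_eig (h : IsChain Q t u₁ u₂) (hv : IsEig Q t v) : IsChain Q t u₁ (u₂ + v) := by
  refine ⟨h.1, fun w => ?_⟩
  rw [rightJ_add, bil_add_left, h.2, bil_add_left, hv, ← map_add]
  ring_nf

end eig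

/-- The matrix of the conjugate form `(u, v) ↦ conj Q(uj, vj)`. -/
def dualForm (Q : Matrix (Fin 4) (Fin 4) ℂ) : Matrix (Fin 4) (Fin 4) ℂ :=
  Jrᵀ * Q.map (starRingEnd ℂ) * Jr

theorem bil_dualForm (Q : Matrix (Fin 4) (Fin 4) ℂ) (u v : Fin 4 → ℂ) :
    bil (dualForm Q) u v = conj (bil Q (rightJ u) (rightJ v)) := by
  rw [dualForm, bil_congr_matrix]
  have h : ∀ u, Jr *ᵥ u = fun i => conj (rightJ u i) := fun u => by
    ext i; fin_cases i <;> simp [Jr, Matrix.mulVec, dotProduct, Fin.sum_univ_four]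
  rw [h, h]
  simp [bil, dotProduct, Matrix.mulVec]

theorem isSymm_dualForm {Q : Matrix (Fin 4) (Fin 4) ℂ} (hQ : Q.IsSymm) : (dualForm Q).IsSymm := by
  rw [Matrix.IsSymm]
  refine ext_bil fun u v => ?_
  have : ∀ (P : Matrix (Fin 4) (Fin 4) ℂ) u v, bil Pᵀ u v = bil P v u := fun P u v => by
    rw [bil, bil, Matrix.dotProduct_mulVec, Matrix.vecMul_transpose, dotProduct_comm]
  rw [this, bil_dualForm, bil_dualForm, bil_comm _ _ hQ]

theorem mulVec_eq_iff_bil {Q : Matrix (Fin 4) (Fin 4) ℂ} {u v : Fin 4 → ℂ} :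
    Q *ᵥ u = v ↔ ∀ w, bil Q w u = w ⬝ᵥ v := by
  refine ⟨fun h w => by rw [bil, h], fun h => ?_⟩
  ext i
  simpa [bil] using h (Pi.single i 1)

theorem isEig_iff {Q : Matrix (Fin 4) (Fin 4) ℂ} (hQ : Q.IsSymm) {t : ℂ} {u : Fin 4 → ℂ} :
    IsEig Q t u ↔ dualForm Q *ᵥ u = t • Q *ᵥ u := by
  rw [mulVec_eq_iff_bil, IsEig]
  refine forall_congr' fun w => ?_
  rw [bil_comm _ _ (isSymm_dualForm hQ), bil_dualForm, dotProduct_smul, ← bil, smul_eq_mul,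
    bil_comm w u hQ]
  constructor <;> intro h
  · rw [h, Complex.conj_conj]
  · rw [← h, Complex.conj_conj]

theorem exists_isEig {Q : Matrix (Fin 4) (Fin 4) ℂ} (hQ : Q.IsSymm) (h0 : Q.det ≠ 0) :
    ∃ t u, u ≠ 0 ∧ IsEig Q t u := by
  obtain ⟨t, ht⟩ := Module.End.exists_eigenvalue (Matrix.toLin' (Q⁻¹ * dualForm Q))
  obtain ⟨u, hu⟩ := ht.exists_hasEigenvector
  refine ⟨t, u, hu.2, (isEig_iff hQ).2 ?_⟩
  have h := hu.apply_eq_smul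
  rw [Matrix.toLin'_apply] at h
  rw [← Matrix.mulVec_smul, ← h, Matrix.mulVec_mulVec,
    Matrix.mul_nonsing_inv_cancel_left _ _ (isUnit_iff_ne_zero.2 h0)]

/-- The range of a symmetric matrix is the orthogonal complement of its kernel. -/
theorem exists_mulVec_eq {M : Matrix (Fin 4) (Fin 4) ℂ} (hM : M.IsSymm) {b : Fin 4 → ℂ}
    (hb : ∀ v, M *ᵥ v = 0 → v ⬝ᵥ b = 0) : ∃ x, M *ᵥ x = b := by
  by_contra hx
  have hx' : b ∉ LinearMap.range M.mulVecLin := fun ⟨x, h⟩ => hx ⟨x, h⟩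
  obtain ⟨f, hf0, hf⟩ := Submodule.exists_le_ker_of_notMem hx'
  set v : Fin 4 → ℂ := fun i => f (Pi.single i 1)
  have hfv : ∀ y, f y = v ⬝ᵥ y := fun y => by
    rw [← LinearMap.sum_single_apply (φ := fun _ : Fin 4 => ℂ) y, map_sum]
    simp only [dotProduct, v]
    refine Finset.sum_congr rfl fun i _ => ?_
    have : (Pi.single i (y i) : Fin 4 → ℂ) = y i • Pi.single i 1 := by
      rw [← Pi.single_smul, smul_eq_mul, mul_one]
    rw [this, map_smul, smul_eq_mul, mul_comm]
    simp
  refine hf0 ?_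
  rw [hfv]
  refine hb v ?_
  ext i
  have h1 : f (M *ᵥ Pi.single i 1) = 0 := hf ⟨_, rfl⟩
  rw [hfv, ← bil, bil_comm _ _ hM] at h1
  simpa [bil] using h1

/-- An eigenvector orthogonal to its whole eigenspace starts a Jordan chain. -/
theorem IsEig.exists_isChain {Q : Matrix (Fin 4) (Fin 4) ℂ} (hQ : Q.IsSymm) {t : ℂ}
    {u : Fin 4 → ℂ} (hu : IsEig Q t u) (h : ∀ w, IsEig Q t w → bil Q w u = 0) :
    ∃ u₂, IsChain Q t u u₂ := by
  have hM : (dualForm Q - t • Q).IsSymm := (isSymm_dualForm hQ).sub (hQ.smul t)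
  obtain ⟨x, hx⟩ := exists_mulVec_eq hM (b := Q *ᵥ u) fun v hv => by
    refine h v ((isEig_iff hQ).2 ?_)
    rwa [Matrix.sub_mulVec, Matrix.smul_mulVec, sub_eq_zero] at hv
  refine ⟨x, hu, fun v => ?_⟩
  have h1 : bil (dualForm Q) v x = t * bil Q v x + bil Q v u := by
    have := congrArg (v ⬝ᵥ ·) hx
    simp only [Matrix.sub_mulVec, Matrix.smul_mulVec, dotProduct_sub, dotProduct_smul,
      smul_eq_mul] at this
    simp only [bil]
    linear_combination this
  rw [bil_comm _ _ (isSymm_dualForm hQ), bil_dualForm] at h1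
  rw [bil_comm x v hQ, bil_comm u v hQ, ← h1, Complex.conj_conj]

/-- Two real linear equations in `ℝ³` have a common nonzero solution, and every vector of `ℝ³` is
a multiple of the image of some `(x, y)` under the Hopf map
`(x, y) ↦ (2 Re x ȳ, 2 Im x ȳ, |x|² - |y|²)`. -/
theorem exists_rotation (p q s : ℂ) : ∃ x y : ℂ, (x ≠ 0 ∨ y ≠ 0) ∧
    q * (x * conj x - y * conj y) - p * (x * conj y) + s * (y * conj x) = 0 := by
  let f : (Fin 3 → ℝ) →ₗ[ℝ] ℂ :=
    { toFun := fun n => 2 * q * n 2 - p * (n 0 + Complex.I * n 1) + s * (n 0 - Complex.I * n 1)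
      map_add' := fun m n => by simp; ring
      map_smul' := fun c n => by simp; ring }
  have hker : LinearMap.ker f ≠ ⊥ := LinearMap.ker_ne_bot_of_finrank_lt (by simp)
  obtain ⟨n, hn, hn0⟩ := Submodule.exists_mem_ne_zero_of_ne_bot hker
  have hf : 2 * q * n 2 - p * (n 0 + Complex.I * n 1) + s * (n 0 - Complex.I * n 1) = 0 := hn
  set R := √(n 0 ^ 2 + n 1 ^ 2 + n 2 ^ 2)
  have hR : R ^ 2 = n 0 ^ 2 + n 1 ^ 2 + n 2 ^ 2 := Real.sq_sqrt (by positivity)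
  by_cases h : R + n 2 = 0
  · refine ⟨0, 1, by simp, ?_⟩
    have hz : n 0 ^ 2 + n 1 ^ 2 = 0 := by
      have : R = -n 2 := by linarith
      rw [this] at hR
      linarith
    have hz0 : n 0 = 0 := by nlinarith [sq_nonneg (n 0), sq_nonneg (n 1)]
    have hz1 : n 1 = 0 := by nlinarith [sq_nonneg (n 0), sq_nonneg (n 1)]
    have hz2 : (n 2 : ℂ) ≠ 0 := by
      refine fun h2 => hn0 (funext fun i => ?_)
      have : n 2 = 0 := by exact_mod_cast h2
      fin_cases i <;> simp [hz0, hz1, this]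
    simp [hz0, hz1, hz2] at hf
    simp [hf]
  · refine ⟨((R + n 2 : ℝ) : ℂ), n 0 - Complex.I * n 1, Or.inl (by exact_mod_cast h), ?_⟩
    have hRc : (R : ℂ) ^ 2 = n 0 ^ 2 + n 1 ^ 2 + n 2 ^ 2 := by exact_mod_cast hR
    simp only [map_sub, map_mul, Complex.conj_ofReal, Complex.conj_I, Complex.ofReal_add,
      map_add]
    have hI := Complex.I_sq
    linear_combination (R + n 2 : ℂ) * hf + q * hRc + q * n 1 ^ 2 * hI

/-! ### Diagonalizable forms -/

section line
variable {Q : Matrix (Fin 4) (Fin 4) ℂ}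

/-- Every quaternionic line has a vector that is `Q`-orthogonal to its multiple by `j`. -/
theorem exists_bil_rightJ_eq_zero (hQ : Q.IsSymm) (w : Fin 4 → ℂ) : ∃ x y : ℂ,
    (x ≠ 0 ∨ y ≠ 0) ∧
      bil Q (x • w + y • rightJ w) (rightJ (x • w + y • rightJ w)) = 0 := by
  obtain ⟨x, y, hxy, h⟩ := exists_rotation (bil Q w w) (bil Q w (rightJ w))
    (bil Q (rightJ w) (rightJ w))
  refine ⟨x, y, hxy, ?_⟩
  simp only [rightJ_add, rightJ_smul, rightJ_rightJ, bil_add_left, bil_add_right, bil_smul_left,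
    bil_smul_right, bil_neg_right, bil_comm (rightJ w) w hQ]
  linear_combination h

/-- If `‖t‖ ≠ 1` then `v` itself is orthogonal to `vj`. If `‖t‖ = 1` then all vectors of the line
of `v` are eigenvectors. -/
theorem IsEig.exists_orthogonal (hQ : Q.IsSymm) {t : ℂ} {v : Fin 4 → ℂ} (ht : t ≠ 0)
    (hv : IsEig Q t v) (hvv : bil Q v v ≠ 0) :
    ∃ v', IsEig Q t v' ∧ bil Q v' v' ≠ 0 ∧ bil Q v' (rightJ v') = 0 := by
  by_cases hb : bil Q v (rightJ v) = 0
  · exact ⟨v, hv, hvv, hb⟩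
  have h1 := hv (rightJ v)
  rw [rightJ_rightJ, bil_neg_right, bil_comm _ _ hQ] at h1
  have ht1 : (conj t)⁻¹ = t := by
    have h2 := congrArg norm h1
    rw [norm_neg, RCLike.norm_conj, norm_mul] at h2
    have h3 : ‖t‖ = 1 := by
      have := norm_ne_zero_iff.2 hb
      field_simp at h2
      exact h2.symm
    refine inv_eq_of_mul_eq_one_right ?_
    rw [Complex.conj_mul', h3]
    simp
  have hjv : IsEig Q t (rightJ v) := by simpa only [ht1] using hv.map_rightJ ht
  obtain ⟨x, y, hxy, h⟩ := exists_bil_rightJ_eq_zero hQ v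
  set v' := x • v + y • rightJ v with hv'
  have hv'e : IsEig Q t v' := (hv.smul x).add (hjv.smul y)
  refine ⟨v', hv'e, fun h0 => ?_, h⟩
  have h2 := hv'e v'
  rw [h0, mul_zero, map_zero] at h2
  have h3 := normSq_add_smul x y v
  rw [← hv'] at h3
  have h4 := congrArg (fun u => bil Q u u) h3
  simp only [sub_eq_add_neg, ← neg_smul, bil_add_left, bil_add_right, bil_smul_left,
    bil_smul_right, h0, h, h2, bil_comm (rightJ v') v' hQ, mul_zero, add_zero] at h4
  have := normSq_add_ne_zero hxy
  exact mul_ne_zero this (mul_ne_zero this hvv) h4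

theorem FormEquiv.det_ne_zero {Q' : Matrix (Fin 4) (Fin 4) ℂ} (h : FormEquiv Q Q')
    (h0 : Q.det ≠ 0) : Q'.det ≠ 0 := by
  obtain ⟨G, ⟨-, hG1⟩, γ, hγ, rfl⟩ := h
  rw [Matrix.det_smul, Matrix.det_mul, Matrix.det_mul, Matrix.det_transpose, hG1]
  simp [hγ, h0]

theorem exists_ne_zero_bil_eq_zero (Q : Matrix (Fin 4) (Fin 4) ℂ) (u v : Fin 4 → ℂ) :
    ∃ w, w ≠ 0 ∧ bil Q u w = 0 ∧ bil Q v w = 0 := by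
  let f : (Fin 4 → ℂ) →ₗ[ℂ] (Fin 2 → ℂ) :=
    { toFun := fun w => ![bil Q u w, bil Q v w]
      map_add' := fun a b => by simp
      map_smul' := fun c a => by simp }
  have hker : LinearMap.ker f ≠ ⊥ := LinearMap.ker_ne_bot_of_finrank_lt (by simp)
  obtain ⟨w, hw, hw0⟩ := Submodule.exists_mem_ne_zero_of_ne_bot hker
  have hf : ![bil Q u w, bil Q v w] = 0 := hw
  exact ⟨w, hw0, by simpa using congrFun hf 0, by simpa using congrFun hf 1⟩

/-- A form with a non-isotropic eigenvector is diagonalizable. -/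
theorem IsEig.formEquiv_diagonal (hQ : Q.IsSymm) (h0 : Q.det ≠ 0) {t : ℂ} {v : Fin 4 → ℂ}
    (ht : t ≠ 0) (hv : IsEig Q t v) (hvv : bil Q v v ≠ 0) :
    ∃ d : Fin 4 → ℂ, (∀ i, d i ≠ 0) ∧ FormEquiv Q (Matrix.diagonal d) := by
  obtain ⟨v, hv, hvv, hvj⟩ := hv.exists_orthogonal hQ ht hvv
  obtain ⟨w, hw, hvw, hjw⟩ := exists_ne_zero_bil_eq_zero Q v (rightJ v)
  -- the orthogonal complement of the line of `v` is a quaternionic line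
  have hjj : bil Q (rightJ v) (rightJ w) = 0 := by rw [hv, hvw, mul_zero, map_zero]
  have hvjw : bil Q v (rightJ w) = 0 := by
    have h1 := hv (rightJ w)
    rw [rightJ_rightJ, bil_neg_right, hjw, neg_zero, eq_comm, map_eq_zero] at h1
    exact (mul_eq_zero.1 h1).resolve_left ht
  obtain ⟨x, y, hxy, h⟩ := exists_bil_rightJ_eq_zero hQ w
  set w' := x • w + y • rightJ w with hw'
  have e1 : bil Q v w' = 0 := by simp [hw', hvw, hvjw]
  have e2 : bil Q (rightJ v) w' = 0 := by simp [hw', hjw, hjj]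
  have e3 : bil Q v (rightJ w') = 0 := by simp [hw', hvw, hvjw]
  have e4 : bil Q (rightJ v) (rightJ w') = 0 := by simp [hw', hjw, hjj]
  have hw0 : w' ≠ 0 := smul_add_smul_rightJ_ne_zero hxy hw
  have hjv : bil Q (rightJ v) (rightJ v) ≠ 0 := by
    rw [hv, Ne, map_eq_zero]
    exact mul_ne_zero ht hvv
  have hd : (frame v w').det ≠ 0 := fun hd => by
    obtain ⟨a, b, hab⟩ := exists_eq_of_det_frame_eq_zero (by rintro rfl; simp at hvv) hd
    rw [hab] at e1 e2
    simp [hvj, hvv] at e1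
    simp [hjv, bil_comm (rightJ v) v hQ, hvj] at e2
    exact hw0 (by rw [hab, e1, e2]; simp)
  have key : FormEquiv Q (Matrix.diagonal ![bil Q v v, bil Q (rightJ v) (rightJ v), bil Q w' w',
      bil Q (rightJ w') (rightJ w')]) := by
    refine formEquiv_of_gram hQ (Matrix.isSymm_diagonal _) hd one_ne_zero ?_ ?_ ?_ ?_ ?_ ?_ ?_ ?_
      ?_ ?_ <;> simp [e1, e2, e3, e4, hvj, h]
  refine ⟨_, fun i hi => ?_, key⟩
  refine key.det_ne_zero h0 ?_
  rw [Matrix.det_diagonal]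
  exact Finset.prod_eq_zero (Finset.mem_univ i) hi

end line

/-! ### The normal form of a Jordan chain -/

/-- The Gram matrix of a normalized Jordan chain with eigenvalue `r > 0`, in the basis
`u₁, u₁j, u₂, u₂j`. -/
def chainForm (r : ℝ) : Matrix (Fin 4) (Fin 4) ℂ :=
  !![0, 0, 1, 0;
     0, 0, 0, r;
     1, 0, 0, 0;
     0, r, 0, 1]

theorem isSymm_chainForm (r : ℝ) : (chainForm r).IsSymm := by
  ext i k; fin_cases i <;> fin_cases k <;> rfl

section chain
variable {Q : Matrix (Fin 4) (Fin 4) ℂ} {r : ℝ} {u₁ u₂ v₁ v₂ : Fin 4 → ℂ}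

theorem IsChain.det_frame_ne_zero (hQ : Q.IsSymm) (h0 : Q.det ≠ 0) (hr : 0 < r)
    (h : IsChain Q r u₁ u₂) (hu : u₁ ≠ 0) : (frame u₁ u₂).det ≠ 0 := fun hd => by
  have hrc : (r : ℂ) ≠ 0 := by exact_mod_cast hr.ne'
  obtain ⟨a, b, hab⟩ := exists_eq_of_det_frame_eq_zero hu hd
  have hj : IsEig Q (r : ℂ)⁻¹ (rightJ u₁) := by simpa using h.1.map_rightJ hrc
  have h1 : (-1 : ℂ) • u₁ + (b * ((r : ℂ)⁻¹ - r)) • rightJ u₁ = 0 := by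
    refine eq_zero_of_bil hQ h0 fun v => ?_
    have h2 := h.2 v
    have h3 := (h.1.smul a) v
    have h4 := (hj.smul b) v
    rw [hab, rightJ_add, bil_add_left, h3, h4, ← map_add] at h2
    have h5 := (starRingEnd ℂ).injective h2
    simp only [bil_add_left, bil_smul_left] at h5 ⊢
    linear_combination h5
  exact smul_add_smul_rightJ_ne_zero (Or.inl (by simp)) hu h1

/-- The relations between the products of `u₁, u₁j, u₂, u₂j` that hold for every chain. -/
theorem IsChain.bil_eq (hQ : Q.IsSymm) (hr : 0 < r) (h : IsChain Q r u₁ u₂) :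
    bil Q u₁ u₁ = 0 ∧ bil Q u₁ (rightJ u₁) = 0 ∧
      bil Q (rightJ u₁) u₂ = -r * conj (bil Q u₁ (rightJ u₂)) ∧
      ((r : ℂ) ^ 2 - 1) * bil Q u₁ (rightJ u₂) = 0 ∧
      -bil Q u₂ (rightJ u₂) = r * conj (bil Q u₂ (rightJ u₂)) + conj (bil Q u₁ (rightJ u₂)) := by
  have a1 := h.1 u₂
  have a2 := h.2 u₁
  have b1 := h.1 (rightJ u₁)
  have b2 := h.1 (rightJ u₂)
  have b3 := h.2 (rightJ u₁)
  have b4 := h.2 (rightJ u₂)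
  simp only [rightJ_rightJ, bil_neg_right, map_mul, map_add, Complex.conj_ofReal]
    at a1 a2 b1 b2 b3 b4
  rw [bil_comm _ _ hQ, a1, bil_comm u₂ u₁ hQ] at a2
  rw [bil_comm _ _ hQ] at b1
  rw [bil_comm _ u₁ hQ, bil_comm _ (rightJ u₁) hQ] at b3
  rw [bil_comm _ u₂ hQ] at b4
  have hb : bil Q u₁ (rightJ u₁) = conj (((r : ℂ) ^ 2 - 1) * bil Q u₁ (rightJ u₂)) := by
    have b2' := congrArg conj b2
    simp only [map_mul, map_neg, Complex.conj_ofReal, Complex.conj_conj] at b2'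
    rw [← Complex.conj_conj (bil Q u₁ (rightJ u₁))]
    congr 1
    linear_combination -b3 + r * b2'
  have hb0 : bil Q u₁ (rightJ u₁) = 0 := by
    by_contra hne
    have h2 := congrArg norm b1
    rw [norm_neg, norm_mul, RCLike.norm_conj, Complex.norm_real, Real.norm_of_nonneg hr.le] at h2
    have hr1 : r = 1 := by
      have := norm_ne_zero_iff.2 hne
      field_simp at h2
      exact h2.symm
    rw [hr1] at hb
    simp at hb
    exact hne hb
  refine ⟨?_, hb0, ?_, ?_, b4⟩
  · have : conj (bil Q u₁ u₁) = 0 := by linear_combination -a2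
    simpa using this
  · linear_combination -b2
  · rw [hb0, eq_comm, map_eq_zero] at hb
    exact hb

theorem IsChain.bil_ne_zero (hQ : Q.IsSymm) (h0 : Q.det ≠ 0) (hr : 0 < r)
    (h : IsChain Q r u₁ u₂) (hu : u₁ ≠ 0) (he : bil Q u₁ (rightJ u₂) = 0) :
    bil Q u₁ u₂ ≠ 0 := fun hc => by
  obtain ⟨h1, h2, -⟩ := h.bil_eq hQ hr
  refine hu (eq_zero_of_bil hQ h0 fun v => ?_)
  obtain ⟨a, b, c, d, rfl⟩ := exists_eq_of_det_frame_ne_zero (h.det_frame_ne_zero hQ h0 hr hu) v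
  simp [h1, h2, hc, he]

/-- A chain is normalized by scaling it and by adding a multiple of `u₁` to `u₂`. -/
theorem IsChain.formEquiv_of_orthogonal (hQ : Q.IsSymm) (h0 : Q.det ≠ 0) (hr : 0 < r)
    (h : IsChain Q r u₁ u₂) (hu : u₁ ≠ 0) (he : bil Q u₁ (rightJ u₂) = 0)
    (hg : bil Q u₂ (rightJ u₂) = 0) : FormEquiv Q (chainForm r) := by
  have hc := h.bil_ne_zero hQ h0 hr hu he
  obtain ⟨z, hz⟩ := IsAlgClosed.exists_pow_nat_eq (bil Q u₁ u₂)⁻¹ two_pos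
  have hz0 : z ≠ 0 := by
    rintro rfl
    exact inv_ne_zero hc (by simpa using hz.symm)
  have hzc : z ^ 2 * bil Q u₁ u₂ = 1 := by rw [hz, inv_mul_cancel₀ hc]
  obtain ⟨h1, h2, h3, -⟩ := h.bil_eq hQ hr
  rw [he, map_zero, mul_zero] at h3
  set s := -bil Q u₂ u₂ / (2 * bil Q u₁ u₂) with hs
  have h' : IsChain Q r (z • u₁) (z • (u₂ + s • u₁)) := (h.add_eig (h.1.smul s)).smul z
  have hd := h'.det_frame_ne_zero hQ h0 hr (smul_ne_zero hz0 hu)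
  obtain ⟨k1, k2, k3, -⟩ := h'.bil_eq hQ hr
  have c0 : bil Q (z • u₁) (z • (u₂ + s • u₁)) = 1 := by
    simp only [bil_add_right, bil_smul_left, bil_smul_right, h1]
    linear_combination hzc
  have c1 : bil Q (z • (u₂ + s • u₁)) (z • (u₂ + s • u₁)) = 0 := by
    simp only [bil_add_left, bil_add_right, bil_smul_left, bil_smul_right, h1, bil_comm u₂ u₁ hQ]
    rw [hs]
    field_simp
    ring
  have c2 : bil Q (z • u₁) (rightJ (z • (u₂ + s • u₁))) = 0 := by
    simp [he, h2]
  have c3 : bil Q (z • (u₂ + s • u₁)) (rightJ (z • (u₂ + s • u₁))) = 0 := by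
    simp [he, h2, hg, bil_comm u₂ (rightJ u₁) hQ, h3]
  rw [c2, map_zero, mul_zero] at k3
  refine formEquiv_of_gram hQ (isSymm_chainForm r) hd one_ne_zero ?_ ?_ ?_ ?_ ?_ ?_ ?_ ?_ ?_ ?_
  · rw [k1]; simp [chainForm]
  · rw [k2]; simp [chainForm]
  · rw [c0]; simp [chainForm]
  · rw [c2]; simp [chainForm]
  · rw [h'.1, k1]; simp [chainForm]
  · rw [k3]; simp [chainForm]
  · rw [h'.1, c0]; simp [chainForm]
  · rw [c1]; simp [chainForm]
  · rw [c3]; simp [chainForm]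
  · rw [h'.2, c0, c1]; simp [chainForm]

theorem IsChain.add {t : ℂ} (h : IsChain Q t u₁ u₂) (h' : IsChain Q t v₁ v₂) :
    IsChain Q t (u₁ + v₁) (u₂ + v₂) := by
  refine ⟨h.1.add h'.1, fun w => ?_⟩
  rw [rightJ_add, bil_add_left, h.2, h'.2, bil_add_left, bil_add_left, ← map_add]
  ring_nf

/-- A chain for the eigenvalue `1` gives a second one on multiplication by `j`, because `1` is its
own conjugate inverse. -/
theorem IsChain.map_rightJ (h : IsChain Q 1 u₁ u₂) : IsChain Q 1 (-rightJ u₁) (rightJ u₂) := by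
  have h1 : IsEig Q 1 (rightJ u₁) := by simpa using h.1.map_rightJ one_ne_zero
  refine ⟨by simpa using h1.smul (-1), fun w => ?_⟩
  have h2 := h1 w
  have h3 := congrArg conj (h.2 (rightJ w))
  simp only [rightJ_rightJ, bil_neg_left, bil_neg_right, one_mul, map_neg, map_add,
    Complex.conj_conj] at h2 h3 ⊢
  linear_combination h3 - h2

/-- For `r ≠ 1` the products of `u₁`, `u₂` with `u₂j` vanish. For `r = 1` they are removed by
rotating the chain with a quaternion and by adding a multiple of `u₁j` to `u₂`. -/
theorem IsChain.formEquiv_chainForm (hQ : Q.IsSymm) (h0 : Q.det ≠ 0) (hr : 0 < r)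
    (h : IsChain Q r u₁ u₂) (hu : u₁ ≠ 0) : FormEquiv Q (chainForm r) := by
  obtain ⟨-, -, -, h4, h5⟩ := h.bil_eq hQ hr
  by_cases hr1 : r = 1
  · subst hr1
    rw [Complex.ofReal_one] at h
    obtain ⟨-, -, h3, -, h5⟩ := h.bil_eq (r := 1) hQ hr
    have hc : bil Q (rightJ u₁) (rightJ u₂) = conj (bil Q u₁ u₂) := by rw [h.1, one_mul]
    obtain ⟨x, y, hxy, hrot⟩ := exists_rotation (bil Q u₁ u₂) (bil Q u₁ (rightJ u₂))
      (-conj (bil Q u₁ u₂))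
    have he : conj (bil Q u₁ (rightJ u₂)) = bil Q u₁ (rightJ u₂) := by
      have := congrArg conj h5
      simp only [map_neg, map_add, map_mul, Complex.conj_conj, Complex.conj_ofReal] at this h5
      push_cast at this h5
      linear_combination this - h5
    rw [he] at h3
    have h' : IsChain Q 1 (x • u₁ + y • (-rightJ u₁)) (x • u₂ + y • rightJ u₂) :=
      (h.smul x).add (h.map_rightJ.smul y)
    have hu' : x • u₁ + y • (-rightJ u₁) ≠ 0 := by
      rw [smul_neg, ← neg_smul]
      exact smul_add_smul_rightJ_ne_zero (hxy.imp id neg_ne_zero.2) hu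
    have he' : bil Q (x • u₁ + y • (-rightJ u₁)) (rightJ (x • u₂ + y • rightJ u₂)) = 0 := by
      simp only [rightJ_add, rightJ_smul, rightJ_rightJ, bil_add_left, bil_add_right,
        bil_smul_left, bil_smul_right, bil_neg_left, bil_neg_right, hc, h3]
      push_cast
      linear_combination hrot
    generalize x • u₁ + y • (-rightJ u₁) = v₁ at *
    generalize x • u₂ + y • rightJ u₂ = v₂ at *
    obtain ⟨k1, k2, k3, -, k5⟩ := h'.bil_eq (r := 1) hQ hr
    have hc' := h'.bil_ne_zero (r := 1) hQ h0 hr hu' he'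
    rw [he'] at k3 k5
    simp only [map_zero, mul_zero, add_zero, Complex.ofReal_one, one_mul] at k3 k5
    have hj : IsEig Q 1 (rightJ v₁) := by simpa using h'.1.map_rightJ one_ne_zero
    have hcc : conj (bil Q v₁ v₂) ≠ 0 := by simpa using hc'
    have hjj : bil Q (rightJ v₁) (rightJ v₂) = conj (bil Q v₁ v₂) := by rw [h'.1, one_mul]
    -- this multiple of `v₁j` removes the product of `v₂` with `v₂j`, which is imaginary by `k5`
    set τ := -bil Q v₂ (rightJ v₂) / (2 * conj (bil Q v₁ v₂)) with hτ
    refine (h'.add_eig (hj.smul τ)).formEquiv_of_orthogonal (r := 1) hQ h0 hr hu' ?_ ?_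
    · simp [he', k1]
    · simp only [rightJ_add, rightJ_smul, rightJ_rightJ, bil_add_left, bil_add_right,
        bil_smul_left, bil_smul_right, bil_neg_right, hjj, bil_comm v₂ v₁ hQ,
        bil_comm (rightJ v₁) v₁ hQ, k2]
      have : conj τ = bil Q v₂ (rightJ v₂) / (2 * bil Q v₁ v₂) := by
        rw [hτ, map_div₀, map_neg, ← k5]
        simp [map_ofNat (starRingEnd ℂ)]
      rw [this, hτ]
      field_simp
      ring
  · have hr1' : (r : ℂ) ^ 2 - 1 ≠ 0 := by
      refine fun h => hr1 ?_
      have : r ^ 2 = 1 := by exact_mod_cast sub_eq_zero.1 h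
      exact (pow_eq_one_iff_of_nonneg hr.le two_ne_zero).1 this
    have he := (mul_eq_zero.1 h4).resolve_left hr1'
    refine h.formEquiv_of_orthogonal hQ h0 hr hu he ?_
    rw [he, map_zero, add_zero] at h5
    by_contra hne
    have h2 := congrArg norm h5
    rw [norm_neg, norm_mul, RCLike.norm_conj, Complex.norm_real, Real.norm_of_nonneg hr.le] at h2
    have := norm_ne_zero_iff.2 hne
    field_simp at h2
    exact hr1 h2.symm

end chain

/-- If every eigenvector is isotropic, then by polarization eigenspaces are totally isotropic, so
each eigenvector starts a chain. Replacing `u` by `uj` if necessary, its eigenvalue has modulus at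
least 1. -/
theorem exists_formEquiv_diagonal_or_chainForm {Q : Matrix (Fin 4) (Fin 4) ℂ} (hQ : Q.IsSymm)
    (h0 : Q.det ≠ 0) : (∃ d : Fin 4 → ℂ, (∀ i, d i ≠ 0) ∧ FormEquiv Q (Matrix.diagonal d)) ∨
      ∃ r : ℝ, 1 ≤ r ∧ FormEquiv Q (chainForm r) := by
  by_cases hiso : ∃ t u, u ≠ 0 ∧ IsEig Q t u ∧ bil Q u u ≠ 0
  · obtain ⟨t, u, hu, ht, huu⟩ := hiso
    exact Or.inl (ht.formEquiv_diagonal hQ h0 (ht.ne_zero hQ h0 hu) huu)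
  push Not at hiso
  right
  have hiso' : ∀ t u, IsEig Q t u → bil Q u u = 0 := fun t u h => by
    by_cases hu : u = 0
    · simp [hu]
    · exact hiso t u hu h
  obtain ⟨t, u, hu, ht1, ht⟩ : ∃ t u, u ≠ 0 ∧ 1 ≤ ‖t‖ ∧ IsEig Q t u := by
    obtain ⟨t, u, hu, ht⟩ := exists_isEig hQ h0
    have ht0 := ht.ne_zero hQ h0 hu
    rcases le_total 1 ‖t‖ with h | h
    · exact ⟨t, u, hu, h, ht⟩
    · refine ⟨_, rightJ u, by simpa using hu, ?_, ht.map_rightJ ht0⟩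
      rw [norm_inv, RCLike.norm_conj]
      exact (one_le_inv₀ (norm_pos_iff.2 ht0)).2 h
  have htn : (‖t‖ : ℂ) ≠ 0 := by
    exact_mod_cast (by linarith : ‖t‖ ≠ 0)
  -- normalize the phase of the eigenvalue
  obtain ⟨γ, hγ⟩ := IsAlgClosed.exists_pow_nat_eq (t / ‖t‖) two_pos
  have hγ1 : ‖γ‖ = 1 := by
    have h1 := congrArg norm hγ
    rw [norm_pow, norm_div, Complex.norm_real, norm_norm, div_self (by linarith)] at h1
    exact (pow_eq_one_iff_of_nonneg (norm_nonneg _) two_ne_zero).1 h1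
  have hγ0 : γ ≠ 0 := norm_ne_zero_iff.1 (by rw [hγ1]; exact one_ne_zero)
  have hγc : γ / conj γ = t / ‖t‖ := by
    have : γ * conj γ = 1 := by rw [Complex.mul_conj', hγ1]; simp
    rw [← hγ, div_eq_iff (by simpa using hγ0)]
    linear_combination -γ * this
  have hQs : (γ • Q).IsSymm := hQ.smul γ
  have h0s : (γ • Q).det ≠ 0 := (formEquiv_smul Q hγ0).det_ne_zero h0
  have hiso2 : ∀ s u, IsEig (γ • Q) s u → bil (γ • Q) u u = 0 := fun s u h => by
    rw [bil_smul_matrix, hiso' _ _ ((isEig_smul_matrix hγ0).1 h), mul_zero]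
  have hs : IsEig (γ • Q) (‖t‖ : ℝ) u := by
    rw [isEig_smul_matrix hγ0, hγc, mul_div_cancel₀ _ htn]
    exact ht
  obtain ⟨u₂, hu₂⟩ := hs.exists_isChain hQs fun w hw => by
    have h1 := hiso2 _ _ (hw.add hs)
    simp only [bil_add_left, bil_add_right, hiso2 _ _ hw, hiso2 _ _ hs, bil_comm u w hQs] at h1
    linear_combination h1 / 2
  exact ⟨‖t‖, ht1, (formEquiv_smul Q hγ0).trans
    (hu₂.formEquiv_chainForm hQs h0s (by linarith) hu)⟩

theorem isSymm_nonDiagForm (k : ℝ) : (nonDiagForm k).IsSymm := by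
  ext i j; fin_cases i <;> fin_cases j <;> rfl

/-- An explicit Jordan chain of `nonDiagForm k`, with eigenvalue `(1 + k) / (1 - k)`. -/
theorem formEquiv_nonDiagForm_chainForm {k : ℝ} (hk1 : k < 1) :
    FormEquiv (nonDiagForm k) (chainForm ((1 + k) / (1 - k))) := by
  have h1 : (1 - k : ℂ) ≠ 0 := by exact_mod_cast (by linarith : 1 - k ≠ 0)
  -- `α` and `β` scale the chain `(0, 0, -1, 1)`, `(1, 1, 0, 0)`, and `σ` makes its second vector
  -- isotropic
  obtain ⟨β, hβ⟩ := IsAlgClosed.exists_pow_nat_eq (Complex.I * (1 - k) / 4) two_pos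
  have hβ0 : β ≠ 0 := by
    rintro rfl
    have : Complex.I * (1 - k) / 4 = 0 := by rw [← hβ]; simp
    simp [h1] at this
  have hβc : conj β ^ 2 = -Complex.I * (1 - k) / 4 := by
    rw [← map_pow, hβ]; simp [map_ofNat (starRingEnd ℂ)]
  have hβc0 : conj β ≠ 0 := by simpa using hβ0
  have hI := Complex.I_sq
  set α : ℂ := -1 / ((1 - k) * β) with hα
  have hαβ : α * β * (1 - k) = -1 := by rw [hα]; field_simp
  have hαc : conj α = -1 / ((1 - k) * conj β) := by rw [hα]; simp
  have hαβc : conj α * conj β * (1 - k) = -1 := by rw [hαc]; field_simp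
  set σ : ℂ := β * (Complex.I / (1 - k)) with hσ
  have hσ' : σ * (1 - k) = β * Complex.I := by rw [hσ]; field_simp
  have hσc : conj σ = conj β * (-Complex.I / (1 - k)) := by rw [hσ]; simp
  have hσc' : conj σ * (1 - k) = -conj β * Complex.I := by rw [hσc]; field_simp
  have hd : (frame ![0, 0, -α, α] ![β, β, -σ, σ]).det ≠ 0 := by
    have : (frame ![0, 0, -α, α] ![β, β, -σ, σ]).det = 4 * (α * conj α * (β * conj β)) := by
      simp [frame, Matrix.det_succ_row_zero, Fin.sum_univ_succ, Fin.succAbove]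
      ring
    rw [this]
    have hα0 : α ≠ 0 := by rintro h; rw [h] at hαβ; simp at hαβ
    have : conj α ≠ 0 := by simpa using hα0
    simp [hα0, hβ0]
  have hb : ∀ u v, bil (nonDiagForm k) u v = Complex.I * (u 0 * v 0 + u 1 * v 1) +
      (-k * (u 0 * v 2 + u 2 * v 0) + k * (u 1 * v 3 + u 3 * v 1) - (u 0 * v 3 + u 3 * v 0) +
        (u 1 * v 2 + u 2 * v 1)) / 2 := fun u v => by
    simp [bil, nonDiagForm, dotProduct, Matrix.mulVec, Fin.sum_univ_four]
    ring
  refine formEquiv_of_gram (isSymm_nonDiagForm k) (isSymm_chainForm _) hd one_ne_zero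
    ?_ ?_ ?_ ?_ ?_ ?_ ?_ ?_ ?_ ?_ <;> rw [hb] <;> simp [chainForm]
  · linear_combination -hαβ
  · rw [eq_div_iff h1]
    linear_combination (-(1 + k) : ℂ) * hαβc
  · linear_combination (-2 * β) * hσ'
  · refine mul_right_cancel₀ h1 ?_
    linear_combination (-2 * (1 + k) * conj β) * hσc' + 4 * Complex.I * hβc - (1 - k) * hI

/-! ### Diagonal forms and the group of parameter transformations -/

theorem bil_diagonal (d u v : Fin 4 → ℂ) : bil (Matrix.diagonal d) u v =
    d 0 * u 0 * v 0 + d 1 * u 1 * v 1 + d 2 * u 2 * v 2 + d 3 * u 3 * v 3 := by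
  simp [bil, dotProduct, Matrix.mulVec_diagonal, Fin.sum_univ_four]
  ring

theorem formEquiv_diagonal_scale (d : Fin 4 → ℂ) {z w γ : ℂ} (hz : z ≠ 0) (hw : w ≠ 0)
    (hγ : γ ≠ 0) : FormEquiv (Matrix.diagonal d) (Matrix.diagonal
      ![γ * z ^ 2 * d 0, γ * conj z ^ 2 * d 1, γ * w ^ 2 * d 2, γ * conj w ^ 2 * d 3]) := by
  have hd : (frame ![z, 0, 0, 0] ![0, 0, w, 0]).det ≠ 0 := by
    simp [frame, Matrix.det_succ_row_zero, Fin.sum_univ_succ, Fin.succAbove, hz, hw]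
  refine formEquiv_of_gram (Matrix.isSymm_diagonal _) (Matrix.isSymm_diagonal _) hd hγ
    ?_ ?_ ?_ ?_ ?_ ?_ ?_ ?_ ?_ ?_ <;> rw [bil_diagonal] <;> simp <;> ring

theorem formEquiv_diagonal_swap_left (d : Fin 4 → ℂ) :
    FormEquiv (Matrix.diagonal d) (Matrix.diagonal ![d 1, d 0, d 2, d 3]) := by
  have hd : (frame ![0, 1, 0, 0] ![0, 0, 1, 0]).det ≠ 0 := by
    simp [frame, Matrix.det_succ_row_zero, Fin.sum_univ_succ, Fin.succAbove]
  refine formEquiv_of_gram (Matrix.isSymm_diagonal _) (Matrix.isSymm_diagonal _) hd one_ne_zero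
    ?_ ?_ ?_ ?_ ?_ ?_ ?_ ?_ ?_ ?_ <;> rw [bil_diagonal] <;> simp

theorem formEquiv_diagonal_swap_pairs (d : Fin 4 → ℂ) :
    FormEquiv (Matrix.diagonal d) (Matrix.diagonal ![d 2, d 3, d 0, d 1]) := by
  have hd : (frame ![0, 0, 1, 0] ![1, 0, 0, 0]).det ≠ 0 := by
    simp [frame, Matrix.det_succ_row_zero, Fin.sum_univ_succ, Fin.succAbove]
  refine formEquiv_of_gram (Matrix.isSymm_diagonal _) (Matrix.isSymm_diagonal _) hd one_ne_zero
    ?_ ?_ ?_ ?_ ?_ ?_ ?_ ?_ ?_ ?_ <;> rw [bil_diagonal] <;> simp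

theorem formEquiv_diagonal_swap_right (d : Fin 4 → ℂ) :
    FormEquiv (Matrix.diagonal d) (Matrix.diagonal ![d 0, d 1, d 3, d 2]) := by
  simpa using ((formEquiv_diagonal_swap_pairs d).trans (formEquiv_diagonal_swap_left _)).trans
    (formEquiv_diagonal_swap_pairs _)

theorem isSymm_diagForm (p : ℝ × ℝ × ℝ) : (diagForm p).IsSymm := Matrix.isSymm_diagonal _

theorem det_diagForm (p : ℝ × ℝ × ℝ) : (diagForm p).det = 1 := by
  rw [diagForm, Matrix.det_diagonal]
  simp only [Fin.prod_univ_four, Matrix.cons_val, ← Complex.exp_add]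
  rw [Complex.exp_eq_one_iff]
  exact ⟨0, by push_cast; ring⟩

/-- The four logarithms of the entries determine the parameters, by comparing exponents. -/
theorem exists_formEquiv_diagForm {d : Fin 4 → ℂ} (hd : ∀ i, d i ≠ 0) :
    ∃ p, FormEquiv (Matrix.diagonal d) (diagForm p) := by
  set α : Fin 4 → ℂ := fun i => Complex.log (d i)
  have hα : ∀ i, d i = Complex.exp (α i) := fun i => (Complex.exp_log (hd i)).symm
  refine ⟨(((α 0).re - (α 1).re) / 2, ((α 2).re - (α 3).re) / 2,
    ((α 0).im + (α 1).im - (α 2).im - (α 3).im) / 4), ?_⟩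
  have h := formEquiv_diagonal_scale d
    (z := Complex.exp ⟨-((α 0).re + (α 1).re) / 4, -((α 0).im - (α 1).im) / 4⟩)
    (w := Complex.exp ⟨-((α 2).re + (α 3).re) / 4, -((α 2).im - (α 3).im) / 4⟩)
    (γ := Complex.exp ⟨0, -((α 0).im + (α 1).im + (α 2).im + (α 3).im) / 4⟩)
    (Complex.exp_ne_zero _) (Complex.exp_ne_zero _) (Complex.exp_ne_zero _)
  convert h using 1
  rw [diagForm]
  congr 1
  simp only [hα, ← Complex.exp_conj, ← Complex.exp_nat_mul, ← Complex.exp_add]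
  ext i
  fin_cases i <;> simp only [Matrix.cons_val, Fin.zero_eta, Fin.mk_one, Fin.reduceFinMk] <;>
    congr 1 <;> apply Complex.ext <;> simp <;> ring

theorem formEquiv_of_mem_Gam {g : Equiv.Perm (ℝ × ℝ × ℝ)} (hg : g ∈ Gam) (p : ℝ × ℝ × ℝ) :
    FormEquiv (diagForm p) (diagForm (g p)) := by
  induction hg using Subgroup.closure_induction generalizing p with
  | mem g hg =>
    rcases hg with rfl | rfl | rfl | rfl <;> simp only [diagForm]
    · convert formEquiv_diagonal_scale _ (z := 1) (w := Complex.I) one_ne_zero Complex.I_ne_zero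
        Complex.I_ne_zero using 2
      have h : Complex.exp (Real.pi / 2 * Complex.I) = Complex.I := Complex.exp_pi_div_two_mul_I
      have h' : Complex.exp (-(Real.pi / 2 * Complex.I)) = -Complex.I := by
        rw [Complex.exp_neg, h, Complex.inv_I]
      ext i
      fin_cases i <;> simp [shiftNu, add_mul, sub_eq_add_neg, Complex.exp_add, h, h',
        mul_comm Complex.I] <;> ring
    · convert formEquiv_diagonal_swap_left _ using 2
      simp [negLam]
    · convert formEquiv_diagonal_swap_right _ using 2
      simp [negMu]
    · convert formEquiv_diagonal_swap_pairs _ using 2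
      simp [swapLamMu, sub_eq_add_neg]
  | one => exact FormEquiv.refl _
  | mul g h _ _ hg hh => exact (hh p).trans (hg (h p))
  | inv g _ hg => simpa using (hg (g⁻¹ p)).symm

/-! ### Orbits of the group of parameter transformations -/

/-- `p` and `p'` lie in the same orbit of `Γ`. -/
def SameOrbit (p p' : ℝ × ℝ × ℝ) : Prop := ∃ g ∈ Gam, g p = p'

theorem SameOrbit.trans {p q r : ℝ × ℝ × ℝ} (h : SameOrbit p q) (h' : SameOrbit q r) :
    SameOrbit p r := by
  obtain ⟨g, hg, rfl⟩ := h
  obtain ⟨g', hg', rfl⟩ := h'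
  exact ⟨g' * g, mul_mem hg' hg, rfl⟩

theorem SameOrbit.symm {p q : ℝ × ℝ × ℝ} (h : SameOrbit p q) : SameOrbit q p := by
  obtain ⟨g, hg, rfl⟩ := h
  exact ⟨g⁻¹, inv_mem hg, by simp⟩

theorem sameOrbit_shift (l m n : ℝ) (k : ℤ) :
    SameOrbit (l, m, n) (l, m, n + k * (Real.pi / 2)) := by
  have h1 : ∀ n, SameOrbit (l, m, n) (l, m, n + Real.pi / 2) := fun n =>
    ⟨shiftNu, Subgroup.subset_closure (by simp), rfl⟩
  induction k using Int.induction_on with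
  | zero => exact ⟨1, one_mem _, by simp⟩
  | succ k ih =>
    convert ih.trans (h1 _) using 3
    push_cast; ring
  | pred k ih =>
    refine ih.trans (SameOrbit.symm ?_)
    convert h1 _ using 3
    push_cast; ring

theorem sameOrbit_abs (l m n : ℝ) : SameOrbit (l, m, n) (|l|, |m|, n) := by
  have h1 : SameOrbit (l, m, n) (|l|, m, n) := by
    rcases abs_choice l with h | h <;> rw [h]
    · exact ⟨1, one_mem _, rfl⟩
    · exact ⟨negLam, Subgroup.subset_closure (by simp), rfl⟩
  refine h1.trans ?_
  rcases abs_choice m with h | h <;> rw [h]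
  · exact ⟨1, one_mem _, rfl⟩
  · exact ⟨negMu, Subgroup.subset_closure (by simp), rfl⟩

theorem sameOrbit_swap (l m n : ℝ) : SameOrbit (l, m, n) (m, l, -n) :=
  ⟨swapLamMu, Subgroup.subset_closure (by simp), rfl⟩

/-- A fundamental domain of `Γ`, up to identifications on its boundary. -/
theorem exists_sameOrbit (p : ℝ × ℝ × ℝ) : ∃ l m n : ℝ, 0 ≤ l ∧ l ≤ m ∧ 0 ≤ n ∧ n < Real.pi / 2 ∧
    SameOrbit p (l, m, n) := by
  obtain ⟨l, m, n⟩ := p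
  obtain ⟨l', m', n', h0, h1, h⟩ : ∃ l' m' n' : ℝ, 0 ≤ l' ∧ l' ≤ m' ∧
      SameOrbit (l, m, n) (l', m', n') := by
    rcases le_total |l| |m| with h | h
    · exact ⟨_, _, _, abs_nonneg l, h, sameOrbit_abs l m n⟩
    · exact ⟨_, _, _, abs_nonneg m, h, (sameOrbit_abs l m n).trans (sameOrbit_swap _ _ _)⟩
  have hpi : 0 < Real.pi / 2 := by positivity
  have h2 := toIcoMod_mem_Ico' hpi n'
  refine ⟨l', m', toIcoMod hpi 0 n', h0, h1, h2.1, h2.2, h.trans ?_⟩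
  convert sameOrbit_shift l' m' n' (-toIcoDiv hpi 0 n') using 3
  rw [toIcoMod, zsmul_eq_mul]
  push_cast
  ring

/-! ### Invariants of a form -/

section invariants
variable {Q : Matrix (Fin 4) (Fin 4) ℂ}

theorem IsEig.of_congr {G : Matrix (Fin 4) (Fin 4) ℂ} (hG : IsQuaternionic G) (h0 : G.det ≠ 0)
    {t : ℂ} {u : Fin 4 → ℂ} (h : IsEig (Gᵀ * Q * G) t u) : IsEig Q t (G *ᵥ u) := fun v => by
  have h1 := h (G⁻¹ *ᵥ v)
  have hr : G *ᵥ (G⁻¹ *ᵥ v) = v := by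
    rw [Matrix.mulVec_mulVec, Matrix.mul_nonsing_inv _ (isUnit_iff_ne_zero.2 h0), Matrix.one_mulVec]
  simpa only [bil_congr_matrix, hG.mulVec_rightJ, hr] using h1

theorem IsChain.of_congr {G : Matrix (Fin 4) (Fin 4) ℂ} (hG : IsQuaternionic G) (h0 : G.det ≠ 0)
    {t : ℂ} {u₁ u₂ : Fin 4 → ℂ} (h : IsChain (Gᵀ * Q * G) t u₁ u₂) :
    IsChain Q t (G *ᵥ u₁) (G *ᵥ u₂) := by
  refine ⟨h.1.of_congr hG h0, fun v => ?_⟩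
  have h1 := h.2 (G⁻¹ *ᵥ v)
  have hr : G *ᵥ (G⁻¹ *ᵥ v) = v := by
    rw [Matrix.mulVec_mulVec, Matrix.mul_nonsing_inv _ (isUnit_iff_ne_zero.2 h0), Matrix.one_mulVec]
  simpa only [bil_congr_matrix, hG.mulVec_rightJ, hr] using h1

theorem IsChain.of_smul_matrix {γ : ℂ} (hγ : γ ≠ 0) {t : ℂ} {u₁ u₂ : Fin 4 → ℂ}
    (h : IsChain (γ • Q) t u₁ u₂) :
    IsChain Q (t * (γ / conj γ)) ((γ / conj γ) • u₁) u₂ := by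
  have hγ' : conj γ ≠ 0 := by simpa using hγ
  refine ⟨((isEig_smul_matrix hγ).1 h.1).smul _, fun v => ?_⟩
  have h1 := h.2 v
  simp only [bil_smul_matrix, bil_smul_left, map_mul, map_add, map_div₀, Complex.conj_conj] at h1 ⊢
  field_simp
  linear_combination h1

theorem mulVec_ne_zero {G : Matrix (Fin 4) (Fin 4) ℂ} (h0 : G.det ≠ 0) {u : Fin 4 → ℂ}
    (hu : u ≠ 0) : G *ᵥ u ≠ 0 := fun h =>
  h0 (Matrix.exists_mulVec_eq_zero_iff.1 ⟨u, hu, h⟩)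

/-- The set of eigenvalues of the conjugate form relative to `Q`. -/
def spec (Q : Matrix (Fin 4) (Fin 4) ℂ) : Set ℂ := {t | ∃ u, u ≠ 0 ∧ IsEig Q t u}

/-- Scaling a form by `γ` rotates its eigenvalues by the phase `γ / conj γ`. -/
theorem mem_spec_congr {G : Matrix (Fin 4) (Fin 4) ℂ} (hG : IsQuaternionic G) (h0 : G.det ≠ 0)
    {γ : ℂ} (hγ : γ ≠ 0) {t : ℂ} :
    t ∈ spec (γ • (Gᵀ * Q * G)) ↔ t * (γ / conj γ) ∈ spec Q := by
  constructor
  · rintro ⟨u, hu, h⟩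
    exact ⟨G *ᵥ u, mulVec_ne_zero h0 hu, ((isEig_smul_matrix hγ).1 h).of_congr hG h0⟩
  · rintro ⟨u, hu, h⟩
    have hr : G *ᵥ (G⁻¹ *ᵥ u) = u := by
      rw [Matrix.mulVec_mulVec, Matrix.mul_nonsing_inv _ (isUnit_iff_ne_zero.2 h0),
        Matrix.one_mulVec]
    refine ⟨G⁻¹ *ᵥ u, mulVec_ne_zero (by simpa [Matrix.det_nonsing_inv] using h0) hu,
      (isEig_smul_matrix hγ).2 fun v => ?_⟩
    rw [bil_congr_matrix, bil_congr_matrix, hG.mulVec_rightJ, hG.mulVec_rightJ, hr]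
    exact h _

theorem isEig_diagonal {d : Fin 4 → ℂ} {t : ℂ} {u : Fin 4 → ℂ} : IsEig (Matrix.diagonal d) t u ↔
    conj (d 1) * u 0 = t * d 0 * u 0 ∧ conj (d 0) * u 1 = t * d 1 * u 1 ∧
    conj (d 3) * u 2 = t * d 2 * u 2 ∧ conj (d 2) * u 3 = t * d 3 * u 3 := by
  constructor
  · intro h
    have h0 := congrArg conj (h ![1, 0, 0, 0])
    have h1 := congrArg conj (h ![0, 1, 0, 0])
    have h2 := congrArg conj (h ![0, 0, 1, 0])
    have h3 := congrArg conj (h ![0, 0, 0, 1])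
    simp [bil_diagonal] at h0 h1 h2 h3
    refine ⟨?_, ?_, ?_, ?_⟩
    · linear_combination h0
    · linear_combination h1
    · linear_combination h2
    · linear_combination h3
  · rintro ⟨h0, h1, h2, h3⟩ v
    rw [← Complex.conj_conj (bil _ (rightJ u) _)]
    congr 1
    simp [bil_diagonal]
    linear_combination v 0 * h0 + v 1 * h1 + v 2 * h2 + v 3 * h3

theorem spec_diagonal {d : Fin 4 → ℂ} (hd : ∀ i, d i ≠ 0) : spec (Matrix.diagonal d) =
    {conj (d 1) / d 0, conj (d 0) / d 1, conj (d 3) / d 2, conj (d 2) / d 3} := by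
  ext t
  simp only [spec, isEig_diagonal, Set.mem_ofPred_eq, Set.mem_insert_iff, Set.mem_singleton_iff,
    eq_div_iff (hd _)]
  constructor
  · rintro ⟨u, hu, h0, h1, h2, h3⟩
    by_contra! h
    refine hu (funext fun i => ?_)
    have key : ∀ {a b x : ℂ}, b ≠ a → a * x = b * x → x = 0 := fun hab h => by
      by_contra hx
      exact hab (mul_right_cancel₀ hx h).symm
    fin_cases i
    · exact key h.1 h0
    · exact key h.2.1 h1
    · exact key h.2.2.1 h2
    · exact key h.2.2.2 h3
  · rintro (h | h | h | h)
    · exact ⟨![1, 0, 0, 0], fun h => by simpa using congrFun h 0, by simp [h]⟩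
    · exact ⟨![0, 1, 0, 0], fun h => by simpa using congrFun h 1, by simp [h]⟩
    · exact ⟨![0, 0, 1, 0], fun h => by simpa using congrFun h 2, by simp [h]⟩
    · exact ⟨![0, 0, 0, 1], fun h => by simpa using congrFun h 3, by simp [h]⟩

theorem not_isChain_diagonal {d : Fin 4 → ℂ} (hd : ∀ i, d i ≠ 0) {t : ℂ} {u₁ u₂ : Fin 4 → ℂ}
    (h : IsChain (Matrix.diagonal d) t u₁ u₂) : u₁ = 0 := by
  obtain ⟨e0, e1, e2, e3⟩ := isEig_diagonal.1 h.1
  have h0 := congrArg conj (h.2 ![1, 0, 0, 0])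
  have h1 := congrArg conj (h.2 ![0, 1, 0, 0])
  have h2 := congrArg conj (h.2 ![0, 0, 1, 0])
  have h3 := congrArg conj (h.2 ![0, 0, 0, 1])
  simp [bil_diagonal] at h0 h1 h2 h3
  have key : ∀ {a b d x y : ℂ}, d ≠ 0 → a * x = b * x → a * y = b * y + d * x → x = 0 :=
    fun {a b d x y} hd h h' => by
      by_contra hx
      have hab := mul_right_cancel₀ hx h
      rw [hab, left_eq_add] at h'
      exact mul_ne_zero hd hx h'
  funext i
  fin_cases i
  · exact (key (hd 0) e0 (y := u₂ 0) (by linear_combination h0) : u₁ 0 = 0)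
  · exact (key (hd 1) e1 (y := u₂ 1) (by linear_combination h1) : u₁ 1 = 0)
  · exact (key (hd 2) e2 (y := u₂ 2) (by linear_combination h2) : u₁ 2 = 0)
  · exact (key (hd 3) e3 (y := u₂ 3) (by linear_combination h3) : u₁ 3 = 0)

theorem bil_chainForm (r : ℝ) (u v : Fin 4 → ℂ) : bil (chainForm r) u v =
    u 0 * v 2 + u 2 * v 0 + r * (u 1 * v 3 + u 3 * v 1) + u 3 * v 3 := by
  simp [bil, chainForm, dotProduct, Matrix.mulVec, Fin.sum_univ_four]
  ring

theorem isChain_chainForm (r : ℝ) : IsChain (chainForm r) r ![1, 0, 0, 0] ![0, 0, 1, 0] := by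
  refine ⟨fun v => ?_, fun v => ?_⟩ <;> simp [bil_chainForm]

theorem eq_or_eq_of_mem_spec_chainForm {r : ℝ} {t : ℂ} (ht : t ∈ spec (chainForm r)) :
    t = r ∨ t * r = 1 := by
  obtain ⟨u, hu, h⟩ := ht
  have h0 := congrArg conj (h ![1, 0, 0, 0])
  have h1 := congrArg conj (h ![0, 1, 0, 0])
  have h2 := congrArg conj (h ![0, 0, 1, 0])
  have h3 := congrArg conj (h ![0, 0, 0, 1])
  simp [bil_chainForm] at h0 h1 h2 h3
  by_contra! hne
  have k3 : u 3 = 0 := by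
    by_contra h
    refine hne.2 (mul_right_cancel₀ h ?_)
    linear_combination -h1
  have k2 : u 2 = 0 := h0.resolve_left hne.1.symm
  have k0 : u 0 = 0 := by
    by_contra h
    refine hne.1 (mul_right_cancel₀ h ?_)
    linear_combination -h2 + k2
  have k1 : u 1 = 0 := by
    by_contra h
    refine hne.2 (mul_right_cancel₀ h ?_)
    linear_combination -h3 - t * k3
  exact hu (funext fun i => by fin_cases i <;> assumption)

end invariants

/-! ### Equivalences between canonical forms -/

theorem norm_div_conj {γ : ℂ} (hγ : γ ≠ 0) : ‖γ / conj γ‖ = 1 := by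
  rw [norm_div, RCLike.norm_conj, div_self (norm_ne_zero_iff.2 hγ)]

theorem eq_of_formEquiv_chainForm {r r' : ℝ} (hr : 1 ≤ r) (hr' : 1 ≤ r')
    (h : FormEquiv (chainForm r) (chainForm r')) : r = r' := by
  obtain ⟨G, ⟨hG, hG1⟩, γ, hγ, h⟩ := h
  have h1 : (r' : ℂ) ∈ spec (chainForm r') :=
    ⟨![1, 0, 0, 0], fun h => by simpa using congrFun h 0, (isChain_chainForm r').1⟩
  rw [h] at h1
  have h2 := (mem_spec_congr hG (by rw [hG1]; exact one_ne_zero) hγ).1 h1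
  rcases eq_or_eq_of_mem_spec_chainForm h2 with h3 | h3
  · have h4 := congrArg norm h3
    rw [norm_mul, norm_div_conj hγ, Complex.norm_real, Complex.norm_real,
      Real.norm_of_nonneg (by linarith), Real.norm_of_nonneg (by linarith)] at h4
    linarith
  · have h4 := congrArg norm h3
    rw [norm_mul, norm_mul, norm_div_conj hγ, Complex.norm_real, Complex.norm_real,
      Real.norm_of_nonneg (by linarith), Real.norm_of_nonneg (by linarith), norm_one] at h4
    nlinarith

theorem not_formEquiv_diagonal_chainForm {d : Fin 4 → ℂ} (hd : ∀ i, d i ≠ 0) (r : ℝ) :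
    ¬ FormEquiv (Matrix.diagonal d) (chainForm r) := by
  rintro ⟨G, ⟨hG, hG1⟩, γ, hγ, h⟩
  have h0 : G.det ≠ 0 := by rw [hG1]; exact one_ne_zero
  have h1 := isChain_chainForm r
  rw [h] at h1
  have h2 := not_isChain_diagonal hd (h1.of_smul_matrix hγ |>.of_congr hG h0)
  refine mulVec_ne_zero h0 (smul_ne_zero ?_ fun h => ?_) h2
  · exact norm_ne_zero_iff.1 (by rw [norm_div_conj hγ]; exact one_ne_zero)
  · simpa using congrFun h 0

/-- The absolute value of the logarithm of the modulus of `t`, and the phase of `t`. The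
eigenvalues `t` and `(conj t)⁻¹`, interchanged by `j`, have the same image. -/
def sizePhase (t : ℂ) : ℝ × ℂ := (|Real.log ‖t‖|, t / ‖t‖)

theorem sizePhase_exp (x : ℝ) (w : ℂ) (hw : ‖w‖ = 1) :
    sizePhase (Complex.exp x * w) = (|x|, w) := by
  have h : ‖Complex.exp x * w‖ = Real.exp x := by
    rw [norm_mul, hw, mul_one, Complex.norm_exp, Complex.ofReal_re]
  rw [sizePhase, h, Real.log_exp, ← Complex.ofReal_exp,
    mul_div_cancel_left₀ _ (by exact_mod_cast (Real.exp_pos x).ne')]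

/-- The spectrum of a diagonal form, rotated by a phase, gives an unordered pair of points, one for
each of the two quaternionic coordinate lines. -/
theorem sizePhase_image_spec_diagForm (l m n : ℝ) (w : ℂ) (hw : ‖w‖ = 1) :
    (fun t => sizePhase (t * w)) '' spec (diagForm (l, m, n)) =
      {(|2 * l|, Complex.exp (-(2 * n) * Complex.I) * w),
        (|2 * m|, Complex.exp (2 * n * Complex.I) * w)} := by
  have hn : ∀ x : ℝ, ‖Complex.exp (x * Complex.I) * w‖ = 1 := fun x => by
    rw [norm_mul, hw, Complex.norm_exp_ofReal_mul_I, mul_one]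
  have key : ∀ x y : ℝ, sizePhase (Complex.exp (x + y * Complex.I) * w) =
      (|x|, Complex.exp (y * Complex.I) * w) := fun x y => by
    rw [Complex.exp_add, mul_assoc, sizePhase_exp _ _ (hn y)]
  rw [diagForm, spec_diagonal (fun i => by fin_cases i <;> exact Complex.exp_ne_zero _)]
  simp only [Matrix.cons_val, ← Complex.exp_conj, ← Complex.exp_sub, Set.image_insert_eq,
    Set.image_singleton]
  have e : ∀ x y : ℝ, ∀ z : ℂ, z = x + y * Complex.I → sizePhase (Complex.exp z * w) =
      (|x|, Complex.exp (y * Complex.I) * w) := fun x y z hz => by rw [hz, key]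
  rw [e (-(2 * l)) (-(2 * n)) _ (by simp; ring), e (2 * l) (-(2 * n)) _ (by simp; ring),
    e (-(2 * m)) (2 * n) _ (by simp; ring), e (2 * m) (2 * n) _ (by simp; ring)]
  simp

theorem exists_eq_add_of_exp_eq {a b : ℝ} {w : ℂ} (hw : w ^ 2 = 1)
    (h : Complex.exp (2 * a * Complex.I) = Complex.exp (2 * b * Complex.I) * w) :
    ∃ k : ℤ, a = b + k * (Real.pi / 2) := by
  have h1 : Complex.exp (4 * a * Complex.I) = Complex.exp (4 * b * Complex.I) := by
    have := congrArg (· ^ 2) h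
    simp only [mul_pow, hw, mul_one, ← Complex.exp_nat_mul] at this
    convert this using 2 <;> push_cast <;> ring
  obtain ⟨k, hk⟩ := Complex.exp_eq_exp_iff_exists_int.1 h1
  refine ⟨k, ?_⟩
  have := congrArg Complex.im hk
  simp at this
  linarith

theorem sameOrbit_of_formEquiv {p p' : ℝ × ℝ × ℝ} (h : FormEquiv (diagForm p) (diagForm p')) :
    SameOrbit p p' := by
  obtain ⟨l, m, n⟩ := p
  obtain ⟨l', m', n'⟩ := p'
  obtain ⟨G, ⟨hG, hG1⟩, γ, hγ, h⟩ := id h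
  have hG0 : G.det ≠ 0 := by rw [hG1]; exact one_ne_zero
  have hγ4 : γ ^ 4 = 1 := by
    have := congrArg Matrix.det h
    rw [Matrix.det_smul, Matrix.det_mul, Matrix.det_mul, Matrix.det_transpose, hG1, det_diagForm,
      det_diagForm, Fintype.card_fin] at this
    linear_combination -this
  set w := γ / conj γ with hw
  have hw1 : ‖w‖ = 1 := norm_div_conj hγ
  -- both forms have determinant `1`, so the phase is a sign
  have hw2 : w ^ 2 = 1 := by
    have hγ1 : ‖γ‖ = 1 := by
      have := congrArg norm hγ4
      rw [norm_pow, norm_one] at this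
      exact (pow_eq_one_iff_of_nonneg (norm_nonneg _) (by norm_num)).1 this
    have h1 : γ * conj γ = 1 := by rw [Complex.mul_conj', hγ1]; simp
    have h2 : w = γ ^ 2 := by
      rw [hw, div_eq_iff (by simpa using hγ)]
      linear_combination -γ * h1
    rw [h2, ← pow_mul, hγ4]
  have hsub : (fun t => t * w) '' spec (diagForm (l', m', n')) = spec (diagForm (l, m, n)) := by
    have hw0 : w ≠ 0 := norm_ne_zero_iff.1 (by rw [hw1]; exact one_ne_zero)
    ext s
    rw [h]
    constructor
    · rintro ⟨t, ht, rfl⟩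
      exact (mem_spec_congr hG hG0 hγ).1 ht
    · intro hs
      refine ⟨s / w, (mem_spec_congr hG hG0 hγ).2 ?_, div_mul_cancel₀ s hw0⟩
      rwa [div_mul_cancel₀ s hw0]
  have himg := sizePhase_image_spec_diagForm l' m' n' w hw1
  rw [← Function.comp_def sizePhase (· * w), Set.image_comp, hsub] at himg
  have himg' := sizePhase_image_spec_diagForm l m n 1 (by simp)
  simp only [mul_one] at himg'
  rw [himg, Set.pair_eq_pair_iff] at himg'
  simp only [Prod.mk.injEq, abs_mul, abs_two] at himg'
  rcases himg' with ⟨⟨hl, -⟩, hm, hn⟩ | ⟨⟨hl, hn⟩, hm, -⟩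
  · obtain ⟨k, rfl⟩ := exists_eq_add_of_exp_eq hw2 hn.symm
    have hl' : |l'| = |l| := by linarith
    have hm' : |m'| = |m| := by linarith
    refine (sameOrbit_abs l m _).trans ?_
    rw [← hl', ← hm']
    refine (SameOrbit.trans (sameOrbit_abs l' m' n') ?_).symm
    exact sameOrbit_shift _ _ _ k
  · have hn' : Complex.exp (2 * n * Complex.I) =
        Complex.exp (2 * ((-n' : ℝ) : ℂ) * Complex.I) * w := by
      rw [← hn]; push_cast; ring_nf
    obtain ⟨k, rfl⟩ := exists_eq_add_of_exp_eq hw2 hn'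
    have hl' : |l'| = |m| := by linarith
    have hm' : |m'| = |l| := by linarith
    refine (sameOrbit_abs l m _).trans ?_
    rw [← hl', ← hm']
    refine SameOrbit.symm ((sameOrbit_abs l' m' n').trans ((sameOrbit_swap _ _ _).trans ?_))
    exact sameOrbit_shift _ _ _ k

theorem det_chainForm_ne_zero {r : ℝ} (hr : r ≠ 0) : (chainForm r).det ≠ 0 := by
  have hr' : (r : ℂ) ≠ 0 := by exact_mod_cast hr
  simp [chainForm, Matrix.det_succ_row_zero, Fin.sum_univ_succ, Fin.succAbove, hr']

theorem det_nonDiagForm_ne_zero {k : ℝ} (hk0 : 0 ≤ k) (hk1 : k < 1) : (nonDiagForm k).det ≠ 0 :=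
  (formEquiv_nonDiagForm_chainForm hk1).symm.det_ne_zero
    (det_chainForm_ne_zero (div_pos (by linarith) (by linarith)).ne')

theorem formEquiv_nonDiagForm_iff {k k' : ℝ} (hk0 : 0 ≤ k) (hk1 : k < 1) (hk0' : 0 ≤ k')
    (hk1' : k' < 1) : FormEquiv (nonDiagForm k) (nonDiagForm k') ↔ k = k' := by
  refine ⟨fun h => ?_, fun h => h ▸ FormEquiv.refl _⟩
  have h1 : 0 < 1 - k := by linarith
  have h1' : 0 < 1 - k' := by linarith
  have h2 := eq_of_formEquiv_chainForm (by rw [le_div_iff₀ h1]; linarith)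
    (by rw [le_div_iff₀ h1']; linarith)
    (((formEquiv_nonDiagForm_chainForm hk1).symm.trans h).trans
      (formEquiv_nonDiagForm_chainForm hk1'))
  rw [div_eq_div_iff h1.ne' h1'.ne'] at h2
  linarith

theorem exists_formEquiv_nonDiagForm {Q : Matrix (Fin 4) (Fin 4) ℂ} {r : ℝ} (hr : 1 ≤ r)
    (h : FormEquiv Q (chainForm r)) : ∃ k : ℝ, 0 ≤ k ∧ k < 1 ∧ FormEquiv Q (nonDiagForm k) := by
  have hk : (r - 1) / (r + 1) < 1 := by rw [div_lt_one (by linarith)]; linarith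
  refine ⟨(r - 1) / (r + 1), div_nonneg (by linarith) (by linarith), hk, h.trans ?_⟩
  have hr1 : r + 1 ≠ 0 := by linarith
  have h1 : (1 + (r - 1) / (r + 1)) / (1 - (r - 1) / (r + 1)) = r := by
    rw [div_eq_iff (by linarith)]
    field_simp
    ring
  have h2 := formEquiv_nonDiagForm_chainForm hk
  rw [h1] at h2
  exact h2.symm

end

end TwistorQuadrics

theorem theorem3 :
    -- every non-singular quadric has a canonical form
    (∀ S : Set TwistorQuadrics.CP3, TwistorQuadrics.IsNonsingularQuadric S →
      (∃ l m n : ℝ, 0 ≤ l ∧ l ≤ m ∧ 0 ≤ n ∧ n < Real.pi / 2 ∧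
        TwistorQuadrics.ConfEquiv S
          (TwistorQuadrics.quadric (TwistorQuadrics.diagForm (l, m, n)))) ∨
      (∃ k : ℝ, 0 ≤ k ∧ k < 1 ∧
        TwistorQuadrics.ConfEquiv S
          (TwistorQuadrics.quadric (TwistorQuadrics.nonDiagForm k)))) ∧
    -- equivalences between diagonal forms are given exactly by the group
    (∀ p p' : ℝ × ℝ × ℝ,
      TwistorQuadrics.ConfEquiv
          (TwistorQuadrics.quadric (TwistorQuadrics.diagForm p))
          (TwistorQuadrics.quadric (TwistorQuadrics.diagForm p')) ↔
        ∃ g ∈ TwistorQuadrics.Gam, g p = p') ∧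
    -- in the second kind, `k` is a complete invariant
    (∀ k k' : ℝ, 0 ≤ k → k < 1 → 0 ≤ k' → k' < 1 →
      (TwistorQuadrics.ConfEquiv
          (TwistorQuadrics.quadric (TwistorQuadrics.nonDiagForm k))
          (TwistorQuadrics.quadric (TwistorQuadrics.nonDiagForm k')) ↔ k = k')) ∧
    -- the second kind is not diagonalizable
    (∀ k : ℝ, 0 ≤ k → k < 1 → ∀ d : Fin 4 → ℂ, (∀ i, d i ≠ 0) →
      ¬ TwistorQuadrics.ConfEquiv
          (TwistorQuadrics.quadric (TwistorQuadrics.nonDiagForm k))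
          (TwistorQuadrics.quadric (Matrix.diagonal d))) ∧
    -- quadrics are equivalent exactly when the symmetric matrices that define them are
    (∀ Q Q' : Matrix (Fin 4) (Fin 4) ℂ, Q.IsSymm → Q'.IsSymm → Q.det ≠ 0 → Q'.det ≠ 0 →
      (TwistorQuadrics.ConfEquiv (TwistorQuadrics.quadric Q) (TwistorQuadrics.quadric Q') ↔
        TwistorQuadrics.FormEquiv Q Q')) := by
  have hd0 : ∀ p, (TwistorQuadrics.diagForm p).det ≠ 0 := fun p => by
    rw [TwistorQuadrics.det_diagForm]; exact one_ne_zero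
  refine ⟨?_, fun p p' => ?_, fun k k' hk0 hk1 hk0' hk1' => ?_, fun k hk0 hk1 d hd h => ?_,
    fun Q Q' hQ hQ' h0 _ => TwistorQuadrics.confEquiv_quadric_iff hQ hQ' h0⟩
  · rintro S ⟨Q, hQ, h0, rfl⟩
    rcases TwistorQuadrics.exists_formEquiv_diagonal_or_chainForm hQ h0 with
      ⟨d, hd, h⟩ | ⟨r, hr, h⟩
    · obtain ⟨p, hp⟩ := TwistorQuadrics.exists_formEquiv_diagForm hd
      obtain ⟨l, m, n, hl, hlm, hn, hn', g, hg, hgp⟩ := TwistorQuadrics.exists_sameOrbit p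
      refine Or.inl ⟨l, m, n, hl, hlm, hn, hn', ?_⟩
      rw [← hgp]
      exact ((h.trans hp).trans (TwistorQuadrics.formEquiv_of_mem_Gam hg p)).confEquiv
    · obtain ⟨k, hk0, hk1, hk⟩ := TwistorQuadrics.exists_formEquiv_nonDiagForm hr h
      exact Or.inr ⟨k, hk0, hk1, hk.confEquiv⟩
  · rw [TwistorQuadrics.confEquiv_quadric_iff (TwistorQuadrics.isSymm_diagForm p)
      (TwistorQuadrics.isSymm_diagForm p') (hd0 p)]
    refine ⟨TwistorQuadrics.sameOrbit_of_formEquiv, ?_⟩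
    rintro ⟨g, hg, rfl⟩
    exact TwistorQuadrics.formEquiv_of_mem_Gam hg p
  · rw [TwistorQuadrics.confEquiv_quadric_iff (TwistorQuadrics.isSymm_nonDiagForm k)
      (TwistorQuadrics.isSymm_nonDiagForm k') (TwistorQuadrics.det_nonDiagForm_ne_zero hk0 hk1),
      TwistorQuadrics.formEquiv_nonDiagForm_iff hk0 hk1 hk0' hk1']
  · rw [TwistorQuadrics.confEquiv_quadric_iff (TwistorQuadrics.isSymm_nonDiagForm k)
      (Matrix.isSymm_diagonal d) (TwistorQuadrics.det_nonDiagForm_ne_zero hk0 hk1)] at h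
    exact TwistorQuadrics.not_formEquiv_diagonal_chainForm hd _
      (h.symm.trans (TwistorQuadrics.formEquiv_nonDiagForm_chainForm hk1))
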